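/- Let $0<s<1$ and let $l\ge 1$ be an integer; put $h=2^{-l}$, $\mu=h^s$, and suppose that $$\mu\le\min\Big\{\tfrac14,\ (1-s)^s,\ \tfrac12\,(2^{l-1}-1)^{s/2}\Big\}$$ (which holds for all large $l$). For $n\ge 1$ let $\mathcal S_n=\{(h^{n-1}(m+\frac12),\,h^{n-1}(m+\frac12)+h^{n+1}) : m\in\mathbb Z\}$, and let $\mathcal S\subset\mathbb R\times\mathbb R$ (the *shortcuts*) be the set of all pairs $(p,q)$ such that $(p,q)$ or $(q,p)$ lies in $\bigcup_{n\ge1}\mathcal S_n$. Write $x\mathcal R y$ if $(x,y)\in\mathcal S$ or $x=y$. For a distance $d$ and a relation $\mathcal Q$ on a set $X$, the quotient semi-distance is $$d_{\mathcal Q}(x,y)=\inf\Big\{\sum_{k=0}^N d(x_k,y_k)\ :\ N\ge 0,\ x\mathcal Q x_0,\ y_k\mathcal Q x_{k+1}\ (0\le k<N),\ y_N\mathcal Q y\Big\}.$$ Let $d_{\mathcal R}$ be the quotient semi-distance on $\mathbb R$ for $d(x,y)=|x-y|^s$ and $\mathcal R$. For $I\subset\mathbb R$ let $\mathcal R_I$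 be the restriction of $\mathcal R$ to $I\times I$ and $d_{\mathcal R_I}$ the quotient semi-distance on $(I,|\cdot|^s)$ for $\mathcal R_I$ (all points of the itineraries lie in $I$). Let $([0,1]/d_{\mathcal R},\overline d_{\mathcal R})$ be the metric space obtained from $([0,1],d_{\mathcal R})$ by identifying points at semi-distance $0$, and $\pi$ the projection onto it. For integers $n\ge0$ and $m$, the interval $[h^nm,h^n(m+1)]$ is *without shortcut at the ends* if no shortcut has $h^nm$ or $h^n(m+1)$ as one of its two points. Let $B(x,r)$ denote open balls and $\mathcal H^\alpha$ Hausdorff measure. A complete metric space $(X,d)$ is Ahlfors $\alpha$-regular ($\alpha>0$) if there is $K>0$ with $K^{-1}r^\alpha\le\mathcal H^\alpha(B(x,r))\le Kr^\alpha$ for all $x\in X$ and finite $r\in(0,\operatorname{diam}X]$. It is a *BPI space of dimension $\alpha$* if it is Ahlfors $\alpha$-regular and there are $C,\theta>0$ such that for all $x,y\in X$ and finite $r,t\in(0,\operatorname{diam}X]$ there are a closed set $A\subset B(x,r)$ with $\mathcal H^\alpha(A)\ge\theta r^\alpha$ and a map $f:A\to B(y,t)$ with $C^{-1}r^{-1}d(a,b)\le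 t^{-1}d(f(a),f(b))\le C\,r^{-1}d(a,b)$ for all $a,b\in A$. Then: 1. $\mathcal R$ is an equivalence relation on $\mathbb R$. 2. $([0,1]/d_{\mathcal R},\overline d_{\mathcal R})$ is a BPI space of dimension $1/s$. 3. $d_{\mathcal R}(x,y)=d_{\mathcal R_{[0,1]}}(x,y)$ for all $x,y\in[0,1]$. 4. More generally, if $I=[h^nm,h^n(m+1)]$ ($n\ge0$, $m\in\mathbb Z$) is without shortcut at the ends, then $d_{\mathcal R}(x,y)=d_{\mathcal R_I}(x,y)$ for all $x,y\in I$. 5. If $I=[h^nm,h^n(m+1)]$ and $I'=[h^{n'}m',h^{n'}(m'+1)]$ are both without shortcut at the ends, then $f(x)=h^{n'-n}x+h^{n'}(m'-m)$ maps $I$ bijectively onto $I'$, and $d_{\mathcal R}(f(x),f(y))=\mu^{n'-n}d_{\mathcal R}(x,y)$ for all $x,y\in I$. 6. In 2 the biLipschitz pieces can be taken to be such intervals: there is $\theta>0$ such that for all $x,y\in[0,1]$ and all $r,t\in(0,\operatorname{diam}_{d_{\mathcal R}}[0,1]]$ there are intervals $I,I'\subset[0,1]$ as in 5 with $d_{\mathcal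 R}(x,u)<r$ for $u\in I$, $d_{\mathcal R}(y,u)<t$ for $u\in I'$, $\pi(I)$ closed, $\mathcal H^{1/s}(\pi(I))\ge\theta r^{1/s}$, and such that the map $f$ of 5 satisfies $\mu\, r^{-1}d_{\mathcal R}(u,v)\le t^{-1}d_{\mathcal R}(f(u),f(v))\le\mu^{-1}r^{-1}d_{\mathcal R}(u,v)$ for all $u,v\in I$. -/

import Mathlib

open MeasureTheory Set
open scoped ENNReal

noncomputable section

namespace BPI

/-! ### Ahlfors regularity and BPI spaces -/

/-- The `α`-dimensional Hausdorff measure of a subset of a metric space, for the Borel σ-algebra. -/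
def hausdorff {X : Type*} [MetricSpace X] (α : ℝ) (A : Set X) : ℝ≥0∞ :=
  letI : MeasurableSpace X := borel X
  haveI : BorelSpace X := ⟨rfl⟩
  Measure.hausdorffMeasure α A

/-- `r ∈ (0, diam X]`; the diameter may be infinite, the radius is finite. -/
def IsRadius (X : Type*) [MetricSpace X] (r : ℝ) : Prop :=
  0 < r ∧ ENNReal.ofReal r ≤ Metric.ediam (Set.univ : Set X)

/-- Ahlfors `α`-regularity of a metric space (with respect to its `α`-dimensional Hausdorff
measure); completeness is part of the definition. -/
def AhlforsRegular (X : Type*) [MetricSpace X] (α : ℝ) : Prop :=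
  0 < α ∧ CompleteSpace X ∧ ∃ K : ℝ, 0 < K ∧ ∀ (x : X) (r : ℝ), IsRadius X r →
    ENNReal.ofReal (K⁻¹ * r ^ α) ≤ hausdorff α (Metric.ball x r) ∧
    hausdorff α (Metric.ball x r) ≤ ENNReal.ofReal (K * r ^ α)

/-- BPI space of dimension `α`: an Ahlfors `α`-regular space such that, uniformly, every ball
`B(x, r)` has a closed subset `A` of measure at least `θ r ^ α` and a `C`-biLipschitz map
from `(A, d / r)` to `(B(y, t), d / t)`. -/
def IsBPI (X : Type*) [MetricSpace X] (α : ℝ) : Prop :=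
  AhlforsRegular X α ∧ ∃ C θ : ℝ, 0 < C ∧ 0 < θ ∧
    ∀ (x y : X) (r t : ℝ), IsRadius X r → IsRadius X t →
      ∃ (A : Set X) (f : X → X), IsClosed A ∧ A ⊆ Metric.ball x r ∧
        ENNReal.ofReal (θ * r ^ α) ≤ hausdorff α A ∧
        MapsTo f A (Metric.ball y t) ∧
        ∀ a ∈ A, ∀ b ∈ A,
          C⁻¹ * (r⁻¹ * dist a b) ≤ t⁻¹ * dist (f a) (f b) ∧
          t⁻¹ * dist (f a) (f b) ≤ C * (r⁻¹ * dist a b)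

/-! ### Quotient semi-distances -/

/-- `(u 0, v 0, …, u n, v n)` is an itinerary from `x` to `y` for the relation `R`. -/
def IsItinerary {X : Type*} (R : X → X → Prop) (x y : X) (n : ℕ) (u v : ℕ → X) : Prop :=
  R x (u 0) ∧ (∀ k < n, R (v k) (u (k + 1))) ∧ R (v n) y

/-- The lengths of the itineraries from `x` to `y`. -/
def itineraryLengths {X : Type*} (d : X → X → ℝ) (R : X → X → Prop) (x y : X) : Set ℝ :=
  {L | ∃ (n : ℕ) (u v : ℕ → X), IsItinerary R x y n u v ∧
    L = ∑ k ∈ Finset.range (n + 1), d (u k) (v k)}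

/-- The quotient semi-distance `d_R` of a distance `d` and a relation `R`. -/
def quotDist {X : Type*} (d : X → X → ℝ) (R : X → X → Prop) (x y : X) : ℝ :=
  sInf (itineraryLengths d R x y)

section

variable {X : Type*} {d : X → X → ℝ} {R : X → X → Prop}

theorem itineraryLengths_nonneg (hd : ∀ x y, 0 ≤ d x y) {x y : X} {L : ℝ}
    (hL : L ∈ itineraryLengths d R x y) : 0 ≤ L := by
  obtain ⟨n, u, v, -, rfl⟩ := hL
  exact Finset.sum_nonneg fun k _ => hd _ _

theorem itineraryLengths_bddBelow (hd : ∀ x y, 0 ≤ d x y) (x y : X) :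
    BddBelow (itineraryLengths d R x y) :=
  ⟨0, fun _ hL => itineraryLengths_nonneg hd hL⟩

theorem mem_itineraryLengths (hR : ∀ x, R x x) (x y : X) : d x y ∈ itineraryLengths d R x y :=
  ⟨0, fun _ => x, fun _ => y, ⟨hR x, by simp, hR y⟩, by simp⟩

theorem quotDist_self (hd : ∀ x y, 0 ≤ d x y) (hd0 : ∀ x, d x x = 0) (hR : ∀ x, R x x) (x : X) :
    quotDist d R x x = 0 := by
  apply le_antisymm
  · rw [← hd0 x]
    exact csInf_le (itineraryLengths_bddBelow hd x x) (mem_itineraryLengths hR x x)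
  · exact le_csInf ⟨_, mem_itineraryLengths hR x x⟩ fun L hL => itineraryLengths_nonneg hd hL

theorem itineraryLengths_symm (hds : ∀ x y, d x y = d y x) (hRs : ∀ x y, R x y → R y x)
    {x y : X} {L : ℝ} (hL : L ∈ itineraryLengths d R x y) : L ∈ itineraryLengths d R y x := by
  obtain ⟨n, u, v, ⟨h0, h1, h2⟩, rfl⟩ := hL
  refine ⟨n, fun k => v (n - k), fun k => u (n - k), ⟨?_, ?_, ?_⟩, ?_⟩
  · simpa using hRs _ _ h2
  · intro k hk
    have := h1 (n - (k + 1)) (by omega)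
    rw [show n - (k + 1) + 1 = n - k by omega] at this
    exact hRs _ _ this
  · simpa using hRs _ _ h0
  · rw [← Finset.sum_range_reflect]
    refine Finset.sum_congr rfl fun k _ => ?_
    rw [hds, show n + 1 - 1 - k = n - k by omega]

theorem quotDist_comm (hds : ∀ x y, d x y = d y x) (hRs : ∀ x y, R x y → R y x) (x y : X) :
    quotDist d R x y = quotDist d R y x := by
  unfold quotDist
  congr 1
  ext L
  exact ⟨itineraryLengths_symm hds hRs, itineraryLengths_symm hds hRs⟩

theorem itineraryLengths_add (hd0 : ∀ x, d x x = 0) {x y z : X} {L M : ℝ}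
    (hL : L ∈ itineraryLengths d R x y) (hM : M ∈ itineraryLengths d R y z) :
    L + M ∈ itineraryLengths d R x z := by
  obtain ⟨n, u, v, ⟨h0, h1, h2⟩, rfl⟩ := hL
  obtain ⟨m, u', v', ⟨h0', h1', h2'⟩, rfl⟩ := hM
  refine ⟨n + 1 + (m + 1),
    fun k => if k ≤ n then u k else if k = n + 1 then y else u' (k - (n + 2)),
    fun k => if k ≤ n then v k else if k = n + 1 then y else v' (k - (n + 2)), ⟨?_, ?_, ?_⟩, ?_⟩
  · simpa using h0
  · intro k hk
    rcases lt_trichotomy k n with h | h | h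
    · simpa [h.le, Nat.succ_le_of_lt h] using h1 k h
    · subst h
      simpa using h2
    · rcases eq_or_lt_of_le (Nat.succ_le_of_lt h) with h' | h'
      · subst h'
        simpa using h0'
      · have := h1' (k - (n + 2)) (by omega)
        rw [show k - (n + 2) + 1 = k + 1 - (n + 2) by omega] at this
        simp only [show ¬ k ≤ n by omega, show ¬ k + 1 ≤ n by omega, show k ≠ n + 1 by omega,
          show k + 1 ≠ n + 1 by omega, if_false]
        exact this
  · simp only [show ¬ n + 1 + (m + 1) ≤ n by omega, show n + 1 + (m + 1) ≠ n + 1 by omega,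
      if_false, show n + 1 + (m + 1) - (n + 2) = m by omega]
    exact h2'
  · rw [show n + 1 + (m + 1) + 1 = (n + 1) + (1 + (m + 1)) by ring,
      Finset.sum_range_add _ (n + 1), Finset.sum_range_add _ 1]
    congr 1
    · refine Finset.sum_congr rfl fun k hk => ?_
      have : k ≤ n := by
        have := Finset.mem_range.1 hk
        omega
      simp [this]
    · rw [Finset.sum_range_one]
      simp only [add_zero, show ¬ n + 1 ≤ n by omega, if_false, if_true, hd0, zero_add]
      refine Finset.sum_congr rfl fun k _ => ?_
      simp only [show ¬ n + 1 + (1 + k) ≤ n by omega, show n + 1 + (1 + k) ≠ n + 1 by omega,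
        if_false, show n + 1 + (1 + k) - (n + 2) = k by omega]

theorem quotDist_triangle (hd : ∀ x y, 0 ≤ d x y) (hd0 : ∀ x, d x x = 0) (hR : ∀ x, R x x)
    (x y z : X) : quotDist d R x z ≤ quotDist d R x y + quotDist d R y z := by
  refine le_of_forall_pos_le_add fun ε hε => ?_
  obtain ⟨L, hL, hL'⟩ := exists_lt_of_csInf_lt ⟨_, mem_itineraryLengths (d := d) hR x y⟩
    (show quotDist d R x y < quotDist d R x y + ε / 2 by linarith)
  obtain ⟨M, hM, hM'⟩ := exists_lt_of_csInf_lt ⟨_, mem_itineraryLengths (d := d) hR y z⟩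
    (show quotDist d R y z < quotDist d R y z + ε / 2 by linarith)
  have : quotDist d R x z ≤ L + M :=
    csInf_le (itineraryLengths_bddBelow hd x z) (itineraryLengths_add hd0 hL hM)
  linarith

end

/-! ### The shortcuts on the real line -/

/-- `h = 2 ^ (-l)`. -/
def scale (l : ℕ) : ℝ := (1 / 2 : ℝ) ^ l

/-- `μ = h ^ s`. -/
def ratio (s : ℝ) (l : ℕ) : ℝ := scale l ^ s

/-- The shortcuts of level `n ≥ 1`, from left to right. -/
def levelShortcuts (l n : ℕ) : Set (ℝ × ℝ) :=
  Set.range fun m : ℤ =>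
    (scale l ^ (n - 1) * ((m : ℝ) + 1 / 2),
      scale l ^ (n - 1) * ((m : ℝ) + 1 / 2) + scale l ^ (n + 1))

/-- The set of all shortcuts; each one can be taken in both directions. -/
def shortcuts (l : ℕ) : Set (ℝ × ℝ) :=
  {z | ∃ n : ℕ, 1 ≤ n ∧ (z ∈ levelShortcuts l n ∨ z.swap ∈ levelShortcuts l n)}

/-- Two points are identified if they are equal or joined by a shortcut. -/
def Rel (l : ℕ) (x y : ℝ) : Prop := (x, y) ∈ shortcuts l ∨ x = y

theorem Rel.refl (l : ℕ) (x : ℝ) : Rel l x x := Or.inr rfl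

theorem Rel.symm (l : ℕ) (x y : ℝ) (h : Rel l x y) : Rel l y x := by
  rcases h with ⟨n, hn, h⟩ | h
  · exact Or.inl ⟨n, hn, h.symm⟩
  · exact Or.inr h.symm

/-- The snowflaked distance `|x - y| ^ s` on the line. -/
def snow (s : ℝ) (x y : ℝ) : ℝ := |x - y| ^ s

/-- The quotient semi-distance `d_R` on the line. -/
def dR (s : ℝ) (l : ℕ) : ℝ → ℝ → ℝ := quotDist (snow s) (Rel l)

/-- The quotient semi-distance of the restrictions of the distance and of the relation to a
subset `I` of the line: its itineraries stay in `I`. -/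
def dRestrict (s : ℝ) (l : ℕ) (I : Set ℝ) : I → I → ℝ :=
  quotDist (fun x y : I => snow s x y) (fun x y : I => Rel l x y)

theorem snow_nonneg (s x y : ℝ) : 0 ≤ snow s x y := Real.rpow_nonneg (abs_nonneg _) _

theorem snow_self {s : ℝ} (hs : 0 < s) (x : ℝ) : snow s x x = 0 := by
  simp [snow, Real.zero_rpow hs.ne']

theorem snow_comm (s x y : ℝ) : snow s x y = snow s y x := by
  simp [snow, abs_sub_comm]

/-- The line with the semi-distance `d_R`. -/
abbrev linePseudoMetric (s : ℝ) (hs : 0 < s) (l : ℕ) : PseudoMetricSpace ℝ where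
  dist := dR s l
  dist_self := quotDist_self (snow_nonneg s) (snow_self hs) (Rel.refl l)
  dist_comm := quotDist_comm (snow_comm s) (Rel.symm l)
  dist_triangle := quotDist_triangle (snow_nonneg s) (snow_self hs) (Rel.refl l)

/-- A copy of the unit interval, to be endowed with `d_R`. -/
def UnitInterval (s : ℝ) (_hs : 0 < s) (_l : ℕ) : Type := Set.Icc (0 : ℝ) 1

/-- The semi-distance `d_R` of the line, restricted to `[0, 1]`. -/
instance (s : ℝ) (hs : 0 < s) (l : ℕ) : PseudoMetricSpace (UnitInterval s hs l) :=
  PseudoMetricSpace.induced (Subtype.val : Set.Icc (0 : ℝ) 1 → ℝ) (linePseudoMetric s hs l)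

/-- The metric space `([0, 1] / d_R, d̄_R)`: points at semi-distance zero are identified. -/
abbrev Quot01 (s : ℝ) (hs : 0 < s) (l : ℕ) : Type := SeparationQuotient (UnitInterval s hs l)

/-- The canonical projection of `[0, 1]` onto `[0, 1] / d_R`. -/
def proj (s : ℝ) (hs : 0 < s) (l : ℕ) (x : Set.Icc (0 : ℝ) 1) : Quot01 s hs l :=
  SeparationQuotient.mk (X := UnitInterval s hs l) x

theorem dist_proj (s : ℝ) (hs : 0 < s) (l : ℕ) (x y : Set.Icc (0 : ℝ) 1) :
    dist (proj s hs l x) (proj s hs l y) = dR s l x y := rfl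

theorem proj_eq_iff (s : ℝ) (hs : 0 < s) (l : ℕ) (x y : Set.Icc (0 : ℝ) 1) :
    proj s hs l x = proj s hs l y ↔ dR s l x y = 0 := by
  rw [← dist_proj s hs l, dist_eq_zero]

/-- The interval `[h ^ n m, h ^ n (m + 1)]`. -/
def cell (l n : ℕ) (m : ℤ) : Set ℝ :=
  Set.Icc (scale l ^ n * (m : ℝ)) (scale l ^ n * ((m : ℝ) + 1))

/-- The interval `[h ^ n m, h ^ n (m + 1)]` has no shortcut at its ends. -/
def NoShortcutAtEnds (l n : ℕ) (m : ℤ) : Prop :=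
  ∀ x : ℝ, (scale l ^ n * (m : ℝ), x) ∉ shortcuts l ∧ (x, scale l ^ n * ((m : ℝ) + 1)) ∉ shortcuts l

/-- The increasing affine map that sends `[h ^ n m, h ^ n (m + 1)]` onto
`[h ^ n' m', h ^ n' (m' + 1)]`. -/
def cellMap (l n : ℕ) (m : ℤ) (n' : ℕ) (m' : ℤ) (x : ℝ) : ℝ :=
  scale l ^ ((n' : ℤ) - (n : ℤ)) * x + scale l ^ n' * ((m' : ℝ) - (m : ℝ))

end BPI

end

noncomputable section

namespace BPI

/-! ### Arithmetic of the shortcuts -/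

/-! Everything rests on two facts, one arithmetic and one metric.

Arithmetic: the left end of a shortcut from `Cut l k` is an odd multiple of `2 ^ (-(l * k + 1))`,
the right end an odd multiple of `2 ^ (-(l * (k + 2)))`. The dyadic level of a point thus tells both
its side and the level of its shortcut, so a point is an end of at most one shortcut and `Rel` is
transitive.

Metric: with `g = h ^ (k + 1)`, a shortcut from `Cut l k` spans only `g h`, whereas its ends are at
least `g (1 - h)` away from the other points that matter at that scale. Since `h ≤ 1 - s`, concavity
of `t ^ s` makes a single jump over the gap no longer than the two jumps around it
(`rpow_add_gap_le`). Between good points of level `n`, all shortcuts of level at least `n` can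
therefore be removed, finest first (`Reach.eliminate_all`). The remaining ones end on the grid of
step `h ^ n`, so good points that are not identified are at distance at least `μ ^ n`
(`Good.le_dR`).

Consequences. Leaving a cell without shortcut at the ends through one end and returning through the
other costs at least `μ ^ n`, so itineraries may stay in the cell
(`NoShortcutAtEnds.dR_eq_dRestrict`); affine maps between such cells carry shortcuts to shortcuts
and are similitudes. A small ball lies near the two ends of a cell and their partners, hence has
Lebesgue measure `O(r ^ (1 / s))`; the mass distribution principle then compares Hausdorff measure
with Lebesgue measure. Every ball contains a comparable cell without shortcut at the ends, which
supplies the big pieces. -/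

theorem scale_pos (l : ℕ) : 0 < scale l := by unfold scale; positivity

theorem scale_pow (l n : ℕ) : scale l ^ n = (1 / 2 : ℝ) ^ (l * n) := by
  rw [scale, pow_mul]

theorem scale_le {l : ℕ} (hl : 3 ≤ l) : scale l ≤ 1 / 8 := by
  calc scale l ≤ (1 / 2 : ℝ) ^ 3 := pow_le_pow_of_le_one (by norm_num) (by norm_num) hl
    _ = 1 / 8 := by norm_num

theorem scale_mul_two_pow (l : ℕ) : scale l * 2 ^ l = 1 := by
  rw [scale, ← mul_pow]; norm_num

theorem scale_pow_eq_mul {l n N : ℕ} (h : n ≤ N) :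
    scale l ^ n = scale l ^ N * ((2 ^ (l * (N - n)) : ℤ) : ℝ) := by
  obtain ⟨j, rfl⟩ := Nat.exists_eq_add_of_le h
  rw [Nat.add_sub_cancel_left, pow_add, pow_mul]
  push_cast
  rw [mul_assoc, ← mul_pow, scale_mul_two_pow, one_pow, mul_one]

/-- `(a, b)` is a shortcut of level `k + 1`, from left to right. -/
def Cut (l k : ℕ) (a b : ℝ) : Prop :=
  ∃ m : ℤ, a = scale l ^ k * (m + 1 / 2) ∧ b = a + scale l ^ (k + 2)

theorem mem_shortcuts {l : ℕ} {x y : ℝ} :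
    (x, y) ∈ shortcuts l ↔ ∃ k, Cut l k x y ∨ Cut l k y x := by
  constructor
  · rintro ⟨n, hn, ⟨m, hm⟩ | ⟨m, hm⟩⟩ <;> obtain ⟨k, rfl⟩ := Nat.exists_eq_add_of_le' hn <;>
      simp only [Nat.add_sub_cancel, Prod.swap_prod_mk, Prod.mk.injEq] at hm
    · exact ⟨k, Or.inl ⟨m, hm.1.symm, by rw [← hm.1, ← hm.2]⟩⟩
    · exact ⟨k, Or.inr ⟨m, hm.1.symm, by rw [← hm.1, ← hm.2]⟩⟩
  · rintro ⟨k, ⟨m, rfl, rfl⟩ | ⟨m, rfl, rfl⟩⟩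
    · exact ⟨k + 1, by omega, Or.inl ⟨m, by simp⟩⟩
    · exact ⟨k + 1, by omega, Or.inr ⟨m, by simp⟩⟩

theorem shortcuts_symm {l : ℕ} {x y : ℝ} (h : (x, y) ∈ shortcuts l) : (y, x) ∈ shortcuts l := by
  rw [mem_shortcuts] at h ⊢
  exact h.imp fun _ => Or.symm

/-- The dyadic level of an odd multiple of a power of `1 / 2` is a lower bound for the level of any
grid that contains it. -/
theorem le_of_odd_eq {A B : ℕ} {a b : ℤ} (ha : Odd a)
    (h : (1 / 2 : ℝ) ^ A * a = (1 / 2 : ℝ) ^ B * b) : A ≤ B := by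
  by_contra! hlt
  obtain ⟨j, rfl⟩ := Nat.exists_eq_add_of_lt hlt
  have h1 : (a : ℝ) = 2 ^ (j + 1) * b := by
    have h2 : (1 / 2 : ℝ) ^ B ≠ 0 := by positivity
    have h3 : (1 / 2 : ℝ) ^ (j + 1) * 2 ^ (j + 1) = 1 := by rw [← mul_pow]; norm_num
    have h4 : (1 / 2 : ℝ) ^ (j + 1) * a = b := by
      apply mul_left_cancel₀ h2
      rw [← h, add_assoc, pow_add]; ring
    rw [← h4, ← mul_assoc, mul_comm (2 ^ (j + 1) : ℝ), h3, one_mul]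
  have h2 : a = 2 ^ (j + 1) * b := by exact_mod_cast h1
  rw [h2, pow_succ, mul_assoc] at ha
  have : Even (2 ^ j * (2 * b)) := (even_two_mul b).mul_left _
  exact (Int.not_even_iff_odd.2 ha) this

/-- The exponent is `1` modulo `l`, while that of a right end is `0` modulo `l`: this separates the
two sides. -/
theorem Cut.left_eq {l k : ℕ} {a b : ℝ} (h : Cut l k a b) :
    ∃ i : ℤ, Odd i ∧ a = (1 / 2 : ℝ) ^ (l * k + 1) * i := by
  obtain ⟨m, rfl, -⟩ := h
  refine ⟨2 * m + 1, odd_two_mul_add_one m, ?_⟩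
  rw [scale_pow, pow_succ]; push_cast; ring

theorem Cut.right_eq {l k : ℕ} (hl : 3 ≤ l) {a b : ℝ} (h : Cut l k a b) :
    ∃ i : ℤ, Odd i ∧ b = (1 / 2 : ℝ) ^ (l * (k + 2)) * i := by
  obtain ⟨m, rfl, rfl⟩ := h
  -- In units of `h ^ (k + 2)` the left end is `2 ^ (2 * l - 1) * (2 * m + 1)`, still even; adding
  -- one unit makes it odd.
  obtain ⟨j, hj⟩ := Nat.exists_eq_add_of_le' (show 2 ≤ l * 2 by omega)
  refine ⟨2 * (2 ^ j * (2 * m + 1)) + 1, odd_two_mul_add_one _, ?_⟩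
  have h1 : scale l ^ k = scale l ^ (k + 2) * 2 ^ (l * 2) := by
    have := scale_pow_eq_mul (l := l) (show k ≤ k + 2 by omega)
    rw [Nat.add_sub_cancel_left] at this
    exact_mod_cast this
  rw [← scale_pow, h1, hj, pow_add]
  push_cast; ring

theorem Cut.level_le_left {l k n : ℕ} {a b : ℝ} {i : ℤ} (h : Cut l k a b)
    (ha : a = scale l ^ n * i) : k + 1 ≤ n := by
  obtain ⟨j, hj, h⟩ := h.left_eq
  rw [ha, scale_pow] at h
  have := le_of_odd_eq hj h.symm
  by_contra! hlt
  have : l * n ≤ l * k := Nat.mul_le_mul_left l (by omega)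
  omega

theorem Cut.level_le_right {l k n : ℕ} (hl : 3 ≤ l) {a b : ℝ} {i : ℤ} (h : Cut l k a b)
    (hb : b = scale l ^ n * i) : k + 2 ≤ n := by
  obtain ⟨j, hj, h⟩ := h.right_eq hl
  rw [hb, scale_pow] at h
  exact Nat.le_of_mul_le_mul_left (le_of_odd_eq hj h.symm) (by omega)

theorem Cut.left_mem {l k n : ℕ} (hl : 3 ≤ l) (hn : k + 1 ≤ n) {a b : ℝ} (h : Cut l k a b) :
    ∃ i : ℤ, a = scale l ^ n * i := by
  obtain ⟨m, rfl, -⟩ := h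
  have h1 := scale_pow_eq_mul (l := l) (show k ≤ n by omega)
  obtain ⟨j, hj⟩ : ∃ j, l * (n - k) = j + 1 := by
    obtain ⟨j, hj⟩ := Nat.exists_eq_add_of_le (show 1 ≤ n - k by omega)
    exact ⟨l * (n - k) - 1, by rw [hj, mul_add]; omega⟩
  refine ⟨2 ^ j * (2 * m + 1), ?_⟩
  rw [h1, hj]; push_cast; ring

theorem Cut.right_mem {l k n : ℕ} (hl : 3 ≤ l) (hn : k + 2 ≤ n) {a b : ℝ} (h : Cut l k a b) :
    ∃ i : ℤ, b = scale l ^ n * i := by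
  obtain ⟨i, hi⟩ := h.left_mem hl (show k + 1 ≤ n by omega)
  obtain ⟨-, -, rfl⟩ := h
  exact ⟨i + 2 ^ (l * (n - (k + 2))), by
    rw [scale_pow_eq_mul hn, hi]; push_cast; ring⟩

theorem Cut.left_level {l k k' : ℕ} (hl : 3 ≤ l) {a b b' : ℝ} (h : Cut l k a b)
    (h' : Cut l k' a b') : k = k' := by
  obtain ⟨i, hi, e⟩ := h.left_eq
  obtain ⟨i', hi', e'⟩ := h'.left_eq
  have h1 := le_of_odd_eq hi (e.symm.trans e')
  have h2 := le_of_odd_eq hi' (e'.symm.trans e)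
  exact Nat.eq_of_mul_eq_mul_left (show 0 < l by omega) (by omega)

theorem Cut.right_level {l k k' : ℕ} (hl : 3 ≤ l) {a a' b : ℝ} (h : Cut l k a b)
    (h' : Cut l k' a' b) : k = k' := by
  obtain ⟨i, hi, e⟩ := h.right_eq hl
  obtain ⟨i', hi', e'⟩ := h'.right_eq hl
  have h1 := le_of_odd_eq hi (e.symm.trans e')
  have h2 := le_of_odd_eq hi' (e'.symm.trans e)
  have := Nat.eq_of_mul_eq_mul_left (show 0 < l by omega) (le_antisymm h1 h2)
  omega

theorem Cut.not_cut {l k k' : ℕ} (hl : 3 ≤ l) {a b c : ℝ} (h : Cut l k a b)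
    (h' : Cut l k' b c) : False := by
  obtain ⟨i, hi, e⟩ := h.right_eq hl
  obtain ⟨i', hi', e'⟩ := h'.left_eq
  have h1 := le_of_odd_eq hi (e.symm.trans e')
  have h2 := le_of_odd_eq hi' (e'.symm.trans e)
  have h3 : l ∣ l * k' + 1 := ⟨k + 2, le_antisymm h2 h1⟩
  have h4 : l ∣ 1 := (Nat.dvd_add_right (dvd_mul_right l k')).1 h3
  have := Nat.le_of_dvd one_pos h4
  omega

theorem Cut.left_unique {l k k' : ℕ} (hl : 3 ≤ l) {a b b' : ℝ} (h : Cut l k a b)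
    (h' : Cut l k' a b') : b = b' := by
  obtain rfl := h.left_level hl h'
  obtain ⟨-, -, rfl⟩ := h
  obtain ⟨-, -, rfl⟩ := h'
  rfl

theorem Cut.right_unique {l k k' : ℕ} (hl : 3 ≤ l) {a a' b : ℝ} (h : Cut l k a b)
    (h' : Cut l k' a' b) : a = a' := by
  obtain rfl := h.right_level hl h'
  obtain ⟨-, -, e⟩ := h
  obtain ⟨-, -, e'⟩ := h'
  linarith

theorem shortcuts_unique {l : ℕ} (hl : 3 ≤ l) {x y z : ℝ} (h : (x, y) ∈ shortcuts l)
    (h' : (x, z) ∈ shortcuts l) : y = z := by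
  obtain ⟨k, h | h⟩ := mem_shortcuts.1 h <;> obtain ⟨k', h' | h'⟩ := mem_shortcuts.1 h'
  · exact h.left_unique hl h'
  · exact (h'.not_cut hl h).elim
  · exact (h.not_cut hl h').elim
  · exact h.right_unique hl h'

theorem rel_equivalence {l : ℕ} (hl : 3 ≤ l) : Equivalence (Rel l) where
  refl := Rel.refl l
  symm := fun h => Rel.symm l _ _ h
  trans := by
    rintro x y z (h | rfl) (h' | rfl)
    · exact Or.inr (shortcuts_unique hl (shortcuts_symm h) h')
    · exact Or.inl h
    · exact Or.inl h'
    · exact Or.inr rfl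

/-- A point is identified with at most one other point. -/
theorem exists_partner {l : ℕ} (hl : 3 ≤ l) (x : ℝ) : ∃ y, ∀ z, Rel l x z → z = x ∨ z = y := by
  by_cases h : ∃ y, (x, y) ∈ shortcuts l
  · obtain ⟨y, hy⟩ := h
    refine ⟨y, ?_⟩
    rintro z (hz | rfl)
    · exact Or.inr (shortcuts_unique hl hz hy)
    · exact Or.inl rfl
  · refine ⟨x, ?_⟩
    rintro z (hz | rfl)
    · exact (h ⟨z, hz⟩).elim
    · exact Or.inl rfl

/-! ### Shortcuts and cells -/

theorem mem_cell_grid {l n : ℕ} {m i : ℤ} (h : scale l ^ n * (i : ℝ) ∈ cell l n m) :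
    i = m ∨ i = m + 1 := by
  have hp : 0 < scale l ^ n := pow_pos (scale_pos l) n
  have h1 : (m : ℝ) ≤ i := le_of_mul_le_mul_left h.1 hp
  have h2 : (i : ℝ) ≤ m + 1 := le_of_mul_le_mul_left h.2 hp
  have h1 : m ≤ i := by exact_mod_cast h1
  have h2 : i ≤ m + 1 := by exact_mod_cast h2
  omega

/-- A cell contains both ends of a shortcut of higher level when it contains one of them. -/
theorem Cut.mem_cell_of_le {l k n : ℕ} (hl : 3 ≤ l) {m : ℤ} {a b : ℝ} (h : Cut l k a b)
    (hk : n ≤ k) (hab : a ∈ cell l n m ∨ b ∈ cell l n m) :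
    a ∈ cell l n m ∧ b ∈ cell l n m := by
  obtain ⟨j, rfl, rfl⟩ := h
  have hp : 0 < scale l ^ k := pow_pos (scale_pos l) k
  have hs := scale_le hl
  have h0 := scale_pos l
  have hq : scale l ^ 2 < 1 / 2 := by nlinarith
  have hq0 : 0 < scale l ^ 2 := by positivity
  have e : scale l ^ k * ((j : ℝ) + 1 / 2) + scale l ^ (k + 2) =
      scale l ^ k * (j + 1 / 2 + scale l ^ 2) := by ring
  simp only [cell, mem_Icc]
  rw [e, scale_pow_eq_mul hk]
  set N : ℤ := 2 ^ (l * (k - n))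
  simp only [mul_assoc, mul_le_mul_iff_right₀ hp]
  simp only [cell, mem_Icc, e, scale_pow_eq_mul hk, mul_assoc, mul_le_mul_iff_right₀ hp] at hab
  have key : N * m ≤ j ∧ j + 1 ≤ N * (m + 1) := by
    have h1 : ((N * m : ℤ) : ℝ) < ((j + 1 : ℤ) : ℝ) := by
      push_cast; rcases hab with h | h <;> linarith [h.1]
    have h2 : ((j : ℤ) : ℝ) < ((N * (m + 1) : ℤ) : ℝ) := by
      push_cast; rcases hab with h | h <;> linarith [h.2]
    have h1 : N * m < j + 1 := by exact_mod_cast h1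
    have h2 : j < N * (m + 1) := by exact_mod_cast h2
    omega
  have h1 : (N : ℝ) * m ≤ j := by exact_mod_cast key.1
  have h2 : (j : ℝ) + 1 ≤ N * (m + 1) := by exact_mod_cast key.2
  refine ⟨⟨?_, ?_⟩, ?_, ?_⟩ <;> linarith

/-- A shortcut whose right end is in a cell of at most its level, and not at an end of the cell,
has its left end at the left end of that cell. -/
theorem Cut.left_eq_of_right_mem {l k n : ℕ} (hl : 3 ≤ l) {m : ℤ} {a b : ℝ} (h : Cut l k a b)
    (hk : k + 1 = n) (hb : b ∈ cell l n m) : a = scale l ^ n * m := by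
  obtain ⟨i, hi⟩ := h.left_mem hl hk.le
  obtain ⟨-, -, rfl⟩ := h
  subst hk
  have hp : 0 < scale l ^ (k + 1) := pow_pos (scale_pos l) _
  have hs := scale_le hl
  have h0 := scale_pos l
  have e : a + scale l ^ (k + 2) = scale l ^ (k + 1) * (i + scale l) := by rw [hi]; ring
  rw [e] at hb
  have h1 : (m : ℝ) ≤ i + scale l := le_of_mul_le_mul_left hb.1 hp
  have h2 : (i : ℝ) + scale l ≤ m + 1 := le_of_mul_le_mul_left hb.2 hp
  have h1 : (m : ℝ) < (i + 1 : ℤ) := by push_cast; linarith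
  have h2 : (i : ℝ) < (m + 1 : ℤ) := by push_cast; linarith
  have h1 : m < i + 1 := by exact_mod_cast h1
  have h2 : i < m + 1 := by exact_mod_cast h2
  rw [hi, show i = m by omega]

/-- A shortcut can leave a cell only at an end of this cell. -/
theorem shortcut_exit {l n : ℕ} (hl : 3 ≤ l) {m : ℤ} {u v : ℝ} (hu : u ∈ cell l n m)
    (hv : v ∉ cell l n m) (h : (u, v) ∈ shortcuts l) :
    u = scale l ^ n * m ∨ u = scale l ^ n * (m + 1) := by
  have key : ∀ i : ℤ, u = scale l ^ n * i →
      u = scale l ^ n * m ∨ u = scale l ^ n * (m + 1) := by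
    rintro i rfl
    rcases mem_cell_grid hu with rfl | rfl
    · exact Or.inl rfl
    · exact Or.inr (by push_cast; rfl)
  obtain ⟨k, h | h⟩ := mem_shortcuts.1 h
  · rcases le_or_gt n k with hk | hk
    · exact (hv (h.mem_cell_of_le hl hk (Or.inl hu)).2).elim
    · obtain ⟨i, hi⟩ := h.left_mem hl hk
      exact key i hi
  · rcases le_or_gt n k with hk | hk
    · exact (hv (h.mem_cell_of_le hl hk (Or.inr hu)).1).elim
    -- Among the levels up to `n`, only level `n` has right ends off the grid of step `h ^ n`; the
    -- matching left end is then the left end of the cell, so the shortcut does not exit.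
    · rcases Nat.eq_or_lt_of_le (Nat.succ_le_of_lt hk) with hk | hk
      · have := h.left_eq_of_right_mem hl hk hu
        refine (hv ?_).elim
        rw [this]
        exact ⟨le_rfl, by gcongr; · exact (pow_pos (scale_pos l) n).le
                          · linarith⟩
      · obtain ⟨i, hi⟩ := h.right_mem hl hk
        exact key i hi

theorem NoShortcutAtEnds.left {l n : ℕ} {m : ℤ} (h : NoShortcutAtEnds l n m) (x : ℝ) :
    (scale l ^ n * m, x) ∉ shortcuts l := (h x).1

theorem NoShortcutAtEnds.right {l n : ℕ} {m : ℤ} (h : NoShortcutAtEnds l n m) (x : ℝ) :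
    (scale l ^ n * (m + 1), x) ∉ shortcuts l := fun h' => (h x).2 (shortcuts_symm h')

theorem NoShortcutAtEnds.mem_of_shortcut {l n : ℕ} (hl : 3 ≤ l) {m : ℤ}
    (h : NoShortcutAtEnds l n m) {u v : ℝ} (hu : u ∈ cell l n m) (huv : (u, v) ∈ shortcuts l) :
    v ∈ cell l n m := by
  by_contra hv
  rcases shortcut_exit hl hu hv huv with rfl | rfl
  · exact h.left _ huv
  · exact h.right _ huv

/-- The shortcuts inside a cell without shortcut at the ends have a higher level than the cell. -/
theorem NoShortcutAtEnds.le_level {l n k : ℕ} (hl : 3 ≤ l) {m : ℤ}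
    (h : NoShortcutAtEnds l n m) {a b : ℝ} (ha : a ∈ cell l n m) (hab : Cut l k a b) :
    n ≤ k := by
  by_contra! hk
  obtain ⟨i, rfl⟩ := hab.left_mem hl hk
  rcases mem_cell_grid ha with rfl | rfl
  · exact h.left _ (mem_shortcuts.2 ⟨k, Or.inl hab⟩)
  · push_cast at hab
    exact h.right _ (mem_shortcuts.2 ⟨k, Or.inl hab⟩)

/-- Scaling only shifts the level; since `n ≤ k`, the translation is an integer multiple of the
period `h ^ (k - n + n')` of the shortcuts of the new level. -/
theorem Cut.cellMap {l k n : ℕ} {a b : ℝ} (h : Cut l k a b) (hk : n ≤ k) (m : ℤ) (n' : ℕ)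
    (m' : ℤ) : Cut l (k - n + n') (cellMap l n m n' m' a) (cellMap l n m n' m' b) := by
  obtain ⟨j, rfl, rfl⟩ := h
  obtain ⟨i, rfl⟩ := Nat.exists_eq_add_of_le hk
  have h0 := (scale_pos l).ne'
  have e : ∀ q : ℕ, scale l ^ ((n' : ℤ) - n) * scale l ^ (n + i + q) = scale l ^ (i + n' + q) := by
    intro q
    rw [← zpow_natCast, ← zpow_natCast, ← zpow_add₀ h0]
    congr 1; push_cast; ring
  have e0 := e 0
  simp only [add_zero] at e0
  rw [Nat.add_sub_cancel_left]
  refine ⟨j + 2 ^ (l * i) * (m' - m), ?_, ?_⟩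
  · have := scale_pow_eq_mul (l := l) (show n' ≤ i + n' by omega)
    rw [Nat.add_sub_cancel] at this
    rw [BPI.cellMap, ← mul_assoc, e0, this]
    push_cast; ring
  · rw [BPI.cellMap, BPI.cellMap, mul_add, e 2]
    ring

theorem NoShortcutAtEnds.rel_cellMap {l n : ℕ} (hl : 3 ≤ l) {m : ℤ} (h : NoShortcutAtEnds l n m)
    (n' : ℕ) (m' : ℤ) {u v : ℝ} (hu : u ∈ cell l n m) (hv : v ∈ cell l n m) (huv : Rel l u v) :
    Rel l (cellMap l n m n' m' u) (cellMap l n m n' m' v) := by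
  rcases huv with huv | rfl
  · obtain ⟨k, hk | hk⟩ := mem_shortcuts.1 huv
    · exact Or.inl (mem_shortcuts.2 ⟨_, Or.inl (hk.cellMap (h.le_level hl hu hk) m n' m')⟩)
    · exact Or.inl (mem_shortcuts.2 ⟨_, Or.inr (hk.cellMap (h.le_level hl hv hk) m n' m')⟩)
  · exact Or.inr rfl

theorem cellMap_cellMap (l n : ℕ) (m : ℤ) (n' : ℕ) (m' : ℤ) (x : ℝ) :
    cellMap l n' m' n m (cellMap l n m n' m' x) = x := by
  have h0 := (scale_pos l).ne'
  have e1 : scale l ^ ((n : ℤ) - n') * scale l ^ ((n' : ℤ) - n) = 1 := by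
    rw [← zpow_add₀ h0]; simp
  have e2 : scale l ^ ((n : ℤ) - n') * scale l ^ n' = scale l ^ n := by
    rw [← zpow_natCast, ← zpow_natCast, ← zpow_add₀ h0]; simp
  unfold cellMap
  linear_combination x * e1 + ((m' : ℝ) - m) * e2

theorem cellMap_mapsTo (l n : ℕ) (m : ℤ) (n' : ℕ) (m' : ℤ) :
    MapsTo (cellMap l n m n' m') (cell l n m) (cell l n' m') := by
  have h0 := (scale_pos l).ne'
  have hp : 0 < scale l ^ ((n' : ℤ) - n) := zpow_pos (scale_pos l) _
  have e2 : scale l ^ ((n' : ℤ) - n) * scale l ^ n = scale l ^ n' := by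
    rw [← zpow_natCast, ← zpow_natCast, ← zpow_add₀ h0]; simp
  rintro x ⟨h1, h2⟩
  have h1 := mul_le_mul_of_nonneg_left h1 hp.le
  have h2 := mul_le_mul_of_nonneg_left h2 hp.le
  rw [← mul_assoc, e2] at h1 h2
  constructor <;> unfold cellMap <;> linarith

theorem cellMap_bijOn (l n : ℕ) (m : ℤ) (n' : ℕ) (m' : ℤ) :
    BijOn (cellMap l n m n' m') (cell l n m) (cell l n' m') :=
  (show InvOn (cellMap l n' m' n m) (cellMap l n m n' m') (cell l n m) (cell l n' m') from
    ⟨fun _ _ => cellMap_cellMap .., fun _ _ => cellMap_cellMap ..⟩).bijOn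
    (cellMap_mapsTo ..) (cellMap_mapsTo ..)

/-! ### Itineraries, step by step -/

/-- `Reach d R x z L`: the point `z` is reached from `x` by jumps of total length `L` and by free
moves between points in relation. -/
inductive Reach {X : Type*} (d : X → X → ℝ) (R : X → X → Prop) (x : X) : X → ℝ → Prop
  | refl : Reach d R x x 0
  | jump {z : X} {L : ℝ} (w : X) : Reach d R x z L → Reach d R x w (L + d z w)
  | cut {z w : X} {L : ℝ} : Reach d R x z L → R z w → Reach d R x w L

section

variable {X : Type*} {d : X → X → ℝ} {R : X → X → Prop}

/-- Splitting itineraries into single moves allows induction with an invariant at the current point.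
Of the converse only the bound `Reach.quotDist_le` is needed. -/
theorem reach_of_mem_itineraryLengths {x y : X} {L : ℝ} (h : L ∈ itineraryLengths d R x y) :
    Reach d R x y L := by
  obtain ⟨n, u, v, ⟨h0, h1, h2⟩, rfl⟩ := h
  refine Reach.cut (z := v n) ?_ h2
  have : ∀ k ≤ n, Reach d R x (v k) (∑ i ∈ Finset.range (k + 1), d (u i) (v i)) := by
    intro k
    induction k with
    | zero => exact fun _ => by simpa using Reach.jump (v 0) (Reach.cut Reach.refl h0)
    | succ k ih =>
      intro hk
      rw [Finset.sum_range_succ]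
      exact Reach.jump _ (Reach.cut (ih (by omega)) (h1 k (by omega)))
  exact this n le_rfl

theorem quotDist_le (hd : ∀ x y, 0 ≤ d x y) (hR : ∀ x, R x x) (x y : X) :
    quotDist d R x y ≤ d x y :=
  csInf_le (itineraryLengths_bddBelow hd x y) (mem_itineraryLengths hR x y)

theorem quotDist_nonneg (hd : ∀ x y, 0 ≤ d x y) (x y : X) : 0 ≤ quotDist d R x y :=
  Real.sInf_nonneg fun _ hL => itineraryLengths_nonneg hd hL

theorem quotDist_eq_zero (hd : ∀ x y, 0 ≤ d x y) (hd0 : ∀ x, d x x = 0) (hR : ∀ x, R x x)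
    {x y : X} (h : R x y) : quotDist d R x y = 0 :=
  le_antisymm (csInf_le (itineraryLengths_bddBelow hd x y)
    ⟨0, fun _ => x, fun _ => x, ⟨hR x, by simp, h⟩, by simp [hd0]⟩) (quotDist_nonneg hd x y)

theorem le_quotDist (hR : ∀ x, R x x) {x y : X} {c : ℝ} (h : ∀ L, Reach d R x y L → c ≤ L) :
    c ≤ quotDist d R x y :=
  le_csInf ⟨_, mem_itineraryLengths hR x y⟩ fun _ hL => h _ (reach_of_mem_itineraryLengths hL)

theorem exists_reach_lt (hR : ∀ x, R x x) {x y : X} {r : ℝ} (h : quotDist d R x y < r) :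
    ∃ L < r, Reach d R x y L := by
  obtain ⟨L, hL, hL'⟩ := exists_lt_of_csInf_lt ⟨_, mem_itineraryLengths (d := d) hR x y⟩ h
  exact ⟨L, hL', reach_of_mem_itineraryLengths hL⟩

theorem Reach.quotDist_le (hd : ∀ x y, 0 ≤ d x y) (hd0 : ∀ x, d x x = 0) (hR : ∀ x, R x x)
    {x y : X} {L : ℝ} (h : Reach d R x y L) : quotDist d R x y ≤ L := by
  induction h with
  | refl => exact (quotDist_self hd hd0 hR x).le
  | jump w _ ih =>
    exact (quotDist_triangle hd hd0 hR x _ w).trans (add_le_add ih (BPI.quotDist_le hd hR _ _))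
  | cut _ hw ih =>
    have := quotDist_triangle hd hd0 hR x _ _ |>.trans
      (add_le_add ih (quotDist_eq_zero hd hd0 hR hw).le)
    simpa using this

theorem Reach.mono {R' : X → X → Prop} {x y : X} {L : ℝ} (h : Reach d R x y L)
    (hR : ∀ a b, R a b → R' a b) : Reach d R' x y L := by
  induction h with
  | refl => exact Reach.refl
  | jump w _ ih => exact Reach.jump w ih
  | cut _ hw ih => exact Reach.cut ih (hR _ _ hw)

end

/-! ### The snowflaked distance -/

theorem snow_le_snow {s : ℝ} (hs : 0 < s) {x y z w : ℝ} (h : |x - y| ≤ |z - w|) :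
    snow s x y ≤ snow s z w := Real.rpow_le_rpow (abs_nonneg _) h hs.le

theorem snow_triangle {s : ℝ} (hs0 : 0 < s) (hs1 : s < 1) (x y z : ℝ) :
    snow s x z ≤ snow s x y + snow s y z := by
  refine (Real.rpow_le_rpow (abs_nonneg _) (abs_sub_le x y z) hs0.le).trans ?_
  exact Real.rpow_add_le_add_rpow (abs_nonneg _) (abs_nonneg _) hs0.le hs1.le

theorem scale_pow_rpow (s : ℝ) (l n : ℕ) : (scale l ^ n) ^ s = ratio s l ^ n := by
  rw [ratio, ← Real.rpow_natCast, ← Real.rpow_natCast, ← Real.rpow_mul (scale_pos l).le,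
    ← Real.rpow_mul (scale_pos l).le, mul_comm]

theorem ratio_pow_le_snow {s : ℝ} (hs0 : 0 < s) {l n : ℕ} {i j : ℤ} (hij : i ≠ j) :
    ratio s l ^ n ≤ snow s (scale l ^ n * i) (scale l ^ n * j) := by
  have hp : 0 < scale l ^ n := pow_pos (scale_pos l) n
  rw [← scale_pow_rpow]
  refine Real.rpow_le_rpow hp.le ?_ hs0.le
  rw [← mul_sub, abs_mul, abs_of_pos hp]
  refine le_mul_of_one_le_right hp.le ?_
  have : (1 : ℤ) ≤ |i - j| := Int.one_le_abs (sub_ne_zero.2 hij)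
  exact_mod_cast this

/-- Two jumps are not shorter than one jump that also covers a much smaller gap. -/
theorem rpow_add_gap_le {s : ℝ} (hs0 : 0 < s) (hs1 : s < 1) {h g A B : ℝ} (hg : 0 < g)
    (hh : 0 ≤ h) (hhs : h ≤ 1 - s) (hA : g * (1 - h) ≤ A) (hB : g * (1 - h) ≤ B) :
    (A + B + g * h) ^ s ≤ A ^ s + B ^ s := by
  wlog hAB : A ≤ B generalizing A B
  · rw [add_comm A B, add_comm (A ^ s)]
    exact this hB hA (le_of_not_ge hAB)
  have h1 : 0 < 1 - h := by linarith
  have hA0 : 0 < A := lt_of_lt_of_le (mul_pos hg h1) hA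
  have hB0 : 0 < B := hA0.trans_le hAB
  have hgh : 0 ≤ g * h := by positivity
  have e : A + B + g * h = B * (1 + (A + g * h) / B) := by field_simp; ring
  rw [e, Real.mul_rpow hB0.le (by positivity)]
  have hb : (1 + (A + g * h) / B) ^ s ≤ 1 + s * ((A + g * h) / B) :=
    rpow_one_add_le_one_add_mul_self (by linarith [show 0 ≤ (A + g * h) / B by positivity])
      hs0.le hs1.le
  have h2 : B ^ s / B ≤ A ^ s / A := by
    rw [← Real.rpow_sub_one hB0.ne', ← Real.rpow_sub_one hA0.ne']
    exact Real.rpow_le_rpow_of_nonpos hA0 hAB (by linarith)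
  -- This says `s g h ≤ (1 - s) A`, and indeed `(1 - s) A ≥ h A ≥ h g (1 - h) ≥ h g s`, using `h ≤ 1
  -- - s` twice.
  have h3 : s * (A + g * h) ≤ A := by nlinarith
  calc B ^ s * (1 + (A + g * h) / B) ^ s ≤ B ^ s * (1 + s * ((A + g * h) / B)) := by gcongr
    _ = B ^ s + s * (A + g * h) * (B ^ s / B) := by ring
    _ ≤ B ^ s + A * (A ^ s / A) := by gcongr
    _ = A ^ s + B ^ s := by field_simp; ring

/-! ### Elimination of the short shortcuts -/

/-- Free moves along the shortcuts of level at most `n`. -/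
def CutBelow (l n : ℕ) (x y : ℝ) : Prop := x = y ∨ ∃ k < n, Cut l k x y ∨ Cut l k y x

/-- The points of the grid of step `h ^ n` that are not an end of a shortcut of level at
least `n`. -/
def Good (l n : ℕ) (x : ℝ) : Prop :=
  (∃ i : ℤ, x = scale l ^ n * i) ∧ ∀ k b, n ≤ k + 1 → ¬ Cut l k x b ∧ ¬ Cut l k b x

theorem mem_grid_of_le {l n N : ℕ} (h : n ≤ N) {x : ℝ} (hx : ∃ i : ℤ, x = scale l ^ n * i) :
    ∃ i : ℤ, x = scale l ^ N * i := by
  obtain ⟨i, rfl⟩ := hx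
  exact ⟨2 ^ (l * (N - n)) * i, by rw [scale_pow_eq_mul h]; push_cast; ring⟩

theorem Good.mono {l n N : ℕ} {x : ℝ} (hx : Good l n x) (h : n ≤ N) : Good l N x :=
  ⟨mem_grid_of_le h hx.1, fun k b hk => hx.2 k b (h.trans hk)⟩

/-- A point of the grid of step `h ^ n` can only be an end of a shortcut of level at most `n`. -/
theorem good_of_mem_grid {l n N : ℕ} (hl : 3 ≤ l) (h : n < N) {x : ℝ}
    (hx : ∃ i : ℤ, x = scale l ^ n * i) : Good l N x := by
  refine ⟨mem_grid_of_le h.le hx, fun k b hk => ⟨fun hc => ?_, fun hc => ?_⟩⟩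
  · obtain ⟨i, hi⟩ := hx
    have := hc.level_le_left hi
    omega
  · obtain ⟨i, hi⟩ := hx
    have := hc.level_le_right hl hi
    omega

theorem NoShortcutAtEnds.good_left {l n : ℕ} {m : ℤ} (h : NoShortcutAtEnds l n m) :
    Good l n (scale l ^ n * m) :=
  ⟨⟨m, rfl⟩, fun k b _ => ⟨fun hc => h.left b (mem_shortcuts.2 ⟨k, Or.inl hc⟩),
    fun hc => h.left b (mem_shortcuts.2 ⟨k, Or.inr hc⟩)⟩⟩

theorem NoShortcutAtEnds.good_right {l n : ℕ} {m : ℤ} (h : NoShortcutAtEnds l n m) :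
    Good l n (scale l ^ n * (m + 1)) :=
  ⟨⟨m + 1, by push_cast; rfl⟩, fun k b _ => ⟨fun hc => h.right b (mem_shortcuts.2 ⟨k, Or.inl hc⟩),
    fun hc => h.right b (mem_shortcuts.2 ⟨k, Or.inr hc⟩)⟩⟩

/-- The ends belong to no other shortcut. The index `n + 1` is needed because the right end lies
only on the grid of step `h ^ (k + 2)`. -/
theorem Cut.good {l k n : ℕ} (hl : 3 ≤ l) (hk : k < n) {a b : ℝ} (h : Cut l k a b) :
    Good l (n + 1) a ∧ Good l (n + 1) b := by
  refine ⟨⟨h.left_mem hl (by omega), fun j c hj => ⟨fun hc => ?_, fun hc => ?_⟩⟩,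
    ⟨h.right_mem hl (by omega), fun j c hj => ⟨fun hc => ?_, fun hc => ?_⟩⟩⟩
  · have := h.left_level hl hc; omega
  · exact hc.not_cut hl h
  · exact h.not_cut hl hc
  · have := h.right_level hl hc; omega

/-- The points of the grid of step `h ^ (k + 1)`, and their translates by `h ^ (k + 2)`, are at
distance at least `h ^ (k + 1) (1 - h)` from each other, unless they come from the same point. -/
theorem le_abs_sub_of_ne {l k : ℕ} {i j : ℤ} (hij : i ≠ j) {x y : ℝ}
    (hx : x = scale l ^ (k + 1) * i ∨ x = scale l ^ (k + 1) * i + scale l ^ (k + 2))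
    (hy : y = scale l ^ (k + 1) * j ∨ y = scale l ^ (k + 1) * j + scale l ^ (k + 2)) :
    scale l ^ (k + 1) * (1 - scale l) ≤ |x - y| := by
  have hp : 0 < scale l ^ (k + 1) := pow_pos (scale_pos l) _
  have h0 := scale_pos l
  have hgh : 0 < scale l ^ (k + 2) := pow_pos (scale_pos l) _
  have e : scale l ^ (k + 1) * (1 - scale l) = scale l ^ (k + 1) - scale l ^ (k + 2) := by ring
  have h1 : scale l ^ (k + 1) ≤ |scale l ^ (k + 1) * i - scale l ^ (k + 1) * j| := by
    rw [← mul_sub, abs_mul, abs_of_pos hp]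
    refine le_mul_of_one_le_right hp.le ?_
    have : (1 : ℤ) ≤ |i - j| := Int.one_le_abs (sub_ne_zero.2 hij)
    exact_mod_cast this
  rw [e]
  rcases hx with rfl | rfl <;> rcases hy with rfl | rfl <;>
    rcases le_abs.1 h1 with h1 | h1 <;> rw [le_abs] <;>
    first
    | (left; linarith)
    | (right; linarith)

/-- `a'` and `b'` are ends of a shortcut of level `k + 1`. -/
def EndsOf (l k : ℕ) (a' b' : ℝ) : Prop :=
  ∃ a b, Cut l k a b ∧ (a' = a ∨ a' = b) ∧ (b' = a ∨ b' = b)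

/-- `rpow_add_gap_le` with `g = h ^ (k + 1)`: the gap between `a'` and `b'` is `0` or `g h`. -/
theorem EndsOf.snow_le {s : ℝ} (hs0 : 0 < s) (hs1 : s < 1) {l k : ℕ}
    (hh : scale l ≤ 1 - s) {a' b' e z : ℝ} (h : EndsOf l k a' b')
    (he : scale l ^ (k + 1) * (1 - scale l) ≤ |e - a'|)
    (hz : scale l ^ (k + 1) * (1 - scale l) ≤ |b' - z|) :
    snow s e z ≤ snow s e a' + snow s b' z := by
  have hp : 0 < scale l ^ (k + 1) := pow_pos (scale_pos l) _
  refine le_trans ?_ (rpow_add_gap_le hs0 hs1 hp (scale_pos l).le hh he hz)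
  refine Real.rpow_le_rpow (abs_nonneg _) ?_ hs0.le
  have h1 : |a' - b'| ≤ scale l ^ (k + 1) * scale l := by
    have e1 : scale l ^ (k + 1) * scale l = scale l ^ (k + 2) := by ring
    have hq : 0 < scale l ^ (k + 2) := pow_pos (scale_pos l) _
    obtain ⟨a, b, ⟨-, -, rfl⟩, rfl | rfl, rfl | rfl⟩ := h <;> rw [e1] <;>
      simp [abs_of_pos hq, hq.le]
  have h2 := abs_sub_le e a' z
  have h3 := abs_sub_le a' b' z
  linarith

theorem EndsOf.grid {l k : ℕ} (hl : 3 ≤ l) {a' b' : ℝ} (h : EndsOf l k a' b') :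
    ∃ i : ℤ, Cut l k (scale l ^ (k + 1) * i) (scale l ^ (k + 1) * i + scale l ^ (k + 2)) ∧
      (a' = scale l ^ (k + 1) * i ∨ a' = scale l ^ (k + 1) * i + scale l ^ (k + 2)) ∧
      (b' = scale l ^ (k + 1) * i ∨ b' = scale l ^ (k + 1) * i + scale l ^ (k + 2)) := by
  obtain ⟨a, b, hab, h⟩ := h
  obtain ⟨i, hi⟩ := hab.left_mem hl le_rfl
  have hb : b = a + scale l ^ (k + 2) := hab.choose_spec.2
  subst hb hi
  exact ⟨i, hab, h⟩

theorem Good.far {l k : ℕ} (hl : 3 ≤ l) {e a' b' : ℝ} (he : Good l (k + 1) e)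
    (h : EndsOf l k a' b') : scale l ^ (k + 1) * (1 - scale l) ≤ |e - a'| := by
  obtain ⟨i, hi, ha, -⟩ := h.grid hl
  obtain ⟨⟨j, rfl⟩, hj⟩ := he
  refine le_abs_sub_of_ne ?_ (Or.inl rfl) ha
  rintro rfl
  exact (hj k _ le_rfl).1 hi

/-- One step of the elimination: the shortcuts of level `k + 1` do not shorten the itineraries
between good points. -/
theorem Reach.eliminate_aux {s : ℝ} (hs0 : 0 < s) (hs1 : s < 1) {l k : ℕ} (hl : 3 ≤ l)
    (hh : scale l ≤ 1 - s) {x z L : ℝ} (hx : Good l (k + 1) x)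
    (h : Reach (snow s) (CutBelow l (k + 1)) x z L) :
    ∃ e M, Good l (k + 1) e ∧ Reach (snow s) (CutBelow l k) x e M ∧
      (M + snow s e z ≤ L ∨
        ∃ a' b', EndsOf l k a' b' ∧ M + snow s e a' + snow s b' z ≤ L) := by
  -- Invariant: `e` is a good point reached without shortcuts of level `k + 1`, and the remaining
  -- budget covers either a direct jump from `e` to `z`, or two jumps around one pending shortcut of
  -- level `k + 1`.
  induction h with
  | refl => exact ⟨x, 0, hx, Reach.refl, Or.inl (by simp [snow_self hs0])⟩
  | @jump z L w _ ih =>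
    obtain ⟨e, M, he, hM, h | ⟨a', b', hab, h⟩⟩ := ih
    · exact ⟨e, M, he, hM, Or.inl (by linarith [snow_triangle hs0 hs1 e z w])⟩
    · exact ⟨e, M, he, hM, Or.inr ⟨a', b', hab, by linarith [snow_triangle hs0 hs1 b' z w]⟩⟩
  | @cut z w L _ hzw ih =>
    obtain rfl | ⟨j, hj, hzw⟩ := hzw
    · exact ih
    obtain ⟨e, M, he, hM, h⟩ := ih
    -- A shortcut of lower level has good ends: the pending shortcut is replaced by a direct jump,
    -- and `w` becomes the new `e`.
    rcases Nat.lt_succ_iff_lt_or_eq.1 hj with hj | rfl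
    · have hg : Good l (k + 1) z ∧ Good l (k + 1) w :=
        hzw.elim (fun h => h.good hl hj) fun h => (h.good hl hj).symm
      refine ⟨w, M + snow s e z, hg.2, Reach.cut (Reach.jump z hM) (Or.inr ⟨j, hj, hzw⟩),
        Or.inl ?_⟩
      rw [snow_self hs0, add_zero]
      rcases h with h | ⟨a', b', hab, h⟩
      · exact h
      · have h1 : EndsOf l k b' a' := by
          obtain ⟨a, b, hc, h1, h2⟩ := hab
          exact ⟨a, b, hc, h2, h1⟩
        have h2 := hg.1.far hl h1
        rw [abs_sub_comm] at h2
        linarith [hab.snow_le hs0 hs1 hh (he.far hl hab) h2]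
    · have hends : EndsOf l j z w := by
        rcases hzw with h | h
        · exact ⟨_, _, h, Or.inl rfl, Or.inr rfl⟩
        · exact ⟨_, _, h, Or.inr rfl, Or.inl rfl⟩
      refine ⟨e, M, he, hM, Or.inr ?_⟩
      rcases h with h | ⟨a', b', hab, h⟩
      · exact ⟨z, w, hends, by simpa [snow_self hs0] using h⟩
      · obtain ⟨i, hi, ha', hb'⟩ := hab.grid hl
        obtain ⟨i', hi', hz, hw⟩ := hends.grid hl
        -- Two passes through the same shortcut merge into one pending shortcut; if the shortcuts
        -- differ, they are far apart and the first is removed by a direct jump from `e`.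
        by_cases hii : i = i'
        · subst hii
          refine ⟨a', w, ⟨_, _, hi, ha', hw⟩, ?_⟩
          rw [snow_self hs0]
          linarith [snow_nonneg s b' z]
        · refine ⟨z, w, hends, ?_⟩
          rw [snow_self hs0]
          linarith [hab.snow_le hs0 hs1 hh (he.far hl hab) (le_abs_sub_of_ne hii hb' hz)]

theorem Reach.eliminate {s : ℝ} (hs0 : 0 < s) (hs1 : s < 1) {l k : ℕ} (hl : 3 ≤ l)
    (hh : scale l ≤ 1 - s) {x y L : ℝ} (hx : Good l (k + 1) x) (hy : Good l (k + 1) y)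
    (h : Reach (snow s) (CutBelow l (k + 1)) x y L) :
    ∃ M ≤ L, Reach (snow s) (CutBelow l k) x y M := by
  obtain ⟨e, M, he, hM, h⟩ := h.eliminate_aux hs0 hs1 hl hh hx
  refine ⟨M + snow s e y, ?_, Reach.jump y hM⟩
  rcases h with h | ⟨a', b', hab, h⟩
  · exact h
  · have h1 : EndsOf l k b' a' := by
      obtain ⟨a, b, hc, h1, h2⟩ := hab
      exact ⟨a, b, hc, h2, h1⟩
    have h2 := hy.far hl h1
    rw [abs_sub_comm] at h2
    linarith [hab.snow_le hs0 hs1 hh (he.far hl hab) h2]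

/-- Levels are removed from the finest to level `n`, good points of level `n` being good for all
finer levels. For `n = 0` the truncated `n - 1` is `0`, and no shortcut remains. -/
theorem Reach.eliminate_all {s : ℝ} (hs0 : 0 < s) (hs1 : s < 1) {l n : ℕ} (hl : 3 ≤ l)
    (hh : scale l ≤ 1 - s) {x y : ℝ} (hx : Good l n x) (hy : Good l n y) (N : ℕ) :
    ∀ L, Reach (snow s) (CutBelow l N) x y L →
      ∃ M ≤ L, Reach (snow s) (CutBelow l (n - 1)) x y M := by
  induction N with
  | zero =>
    intro L h
    refine ⟨L, le_rfl, ?_⟩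
    exact h.mono fun a b hab => hab.imp_right fun ⟨k, hk, _⟩ => absurd hk (Nat.not_lt_zero k)
  | succ N ih =>
    intro L h
    rcases le_or_gt n (N + 1) with hN | hN
    · obtain ⟨M, hM, h⟩ := h.eliminate hs0 hs1 hl hh (hx.mono hN) (hy.mono hN)
      obtain ⟨M', hM', h⟩ := ih M h
      exact ⟨M', hM'.trans hM, h⟩
    · refine ⟨L, le_rfl, ?_⟩
      exact h.mono fun a b hab => hab.imp_right fun ⟨k, hk, h⟩ => ⟨k, by omega, h⟩

theorem Reach.exists_level {s : ℝ} {l : ℕ} {x z L : ℝ} (h : Reach (snow s) (Rel l) x z L) :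
    ∃ N, Reach (snow s) (CutBelow l N) x z L := by
  induction h with
  | refl => exact ⟨0, Reach.refl⟩
  | jump w _ ih =>
    obtain ⟨N, h⟩ := ih
    exact ⟨N, Reach.jump w h⟩
  | cut _ hw ih =>
    obtain ⟨N, h⟩ := ih
    rcases hw with hw | rfl
    · obtain ⟨k, hk⟩ := mem_shortcuts.1 hw
      refine ⟨max N (k + 1), Reach.cut (h.mono fun a b hab => ?_) (Or.inr ⟨k, by omega, hk⟩)⟩
      exact hab.imp_right fun ⟨j, hj, h⟩ => ⟨j, by omega, h⟩
    · exact ⟨N, h⟩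

/-- An itinerary with shortcuts of level less than `n` only, from a point of the grid of step
`h ^ n`, ends near this point or its partner, or is long. -/
theorem Reach.near_or_le {s : ℝ} (hs0 : 0 < s) (hs1 : s < 1) {l n : ℕ} (hl : 3 ≤ l) {x z L : ℝ}
    (hx : ∃ i : ℤ, x = scale l ^ n * i) (h : Reach (snow s) (CutBelow l (n - 1)) x z L) :
    (∃ e, (∃ i : ℤ, e = scale l ^ n * i) ∧ Rel l x e ∧ snow s e z ≤ L) ∨ ratio s l ^ n ≤ L := by
  induction h with
  | refl => exact Or.inl ⟨x, hx, Rel.refl l x, by simp [snow_self hs0]⟩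
  | @jump z L w _ ih =>
    rcases ih with ⟨e, he, hxe, h⟩ | h
    · exact Or.inl ⟨e, he, hxe, by linarith [snow_triangle hs0 hs1 e z w]⟩
    · exact Or.inr (by linarith [snow_nonneg s z w])
  | @cut z w L _ hzw ih =>
    obtain rfl | ⟨j, hj, hzw⟩ := hzw
    · exact ih
    rcases ih with ⟨e, he, hxe, h⟩ | h
    · have hg : (∃ i : ℤ, z = scale l ^ n * i) ∧ ∃ i : ℤ, w = scale l ^ n * i := by
        rcases hzw with h | h
        · exact ⟨h.left_mem hl (by omega), h.right_mem hl (by omega)⟩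
        · exact ⟨h.right_mem hl (by omega), h.left_mem hl (by omega)⟩
      obtain ⟨i, rfl⟩ := he
      obtain ⟨⟨j', rfl⟩, hw⟩ := hg
      -- Either the shortcut starts at `e` itself and stays in the class of `x`, or the jump from
      -- `e` has already crossed a full grid step.
      by_cases hij : i = j'
      · subst hij
        refine Or.inl ⟨w, hw, (rel_equivalence hl).trans hxe (Or.inl (mem_shortcuts.2 ⟨j, hzw⟩)),
          ?_⟩
        rw [snow_self hs0] at h ⊢
        exact h
      · exact Or.inr ((ratio_pow_le_snow hs0 hij).trans h)
    · exact Or.inr h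

/-- Good points of level `n` that are not identified are at distance at least `μ ^ n`. -/
theorem Good.le_dR {s : ℝ} (hs0 : 0 < s) (hs1 : s < 1) {l n : ℕ} (hl : 3 ≤ l)
    (hh : scale l ≤ 1 - s) {x y : ℝ} (hx : Good l n x) (hy : Good l n y) (hxy : ¬ Rel l x y) :
    ratio s l ^ n ≤ dR s l x y := by
  refine le_quotDist (Rel.refl l) fun L hL => ?_
  obtain ⟨N, hN⟩ := hL.exists_level
  obtain ⟨M, hML, hM⟩ := Reach.eliminate_all hs0 hs1 hl hh hx hy N L hN
  refine le_trans ?_ hML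
  rcases hM.near_or_le hs0 hs1 hl hx.1 with ⟨e, ⟨i, rfl⟩, hxe, he⟩ | h
  · obtain ⟨⟨j, rfl⟩, -⟩ := hy
    have hij : i ≠ j := by
      rintro rfl
      exact hxy hxe
    exact (ratio_pow_le_snow hs0 hij).trans he
  · exact h

/-! ### The semi-distance on a cell -/

theorem dR_nonneg (s : ℝ) (l : ℕ) (x y : ℝ) : 0 ≤ dR s l x y :=
  quotDist_nonneg (snow_nonneg s) x y

theorem dR_le_snow (s : ℝ) (l : ℕ) (x y : ℝ) : dR s l x y ≤ snow s x y :=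
  quotDist_le (snow_nonneg s) (Rel.refl l) x y

theorem dR_comm (s : ℝ) (l : ℕ) (x y : ℝ) : dR s l x y = dR s l y x :=
  quotDist_comm (snow_comm s) (Rel.symm l) x y

theorem dR_triangle {s : ℝ} (hs0 : 0 < s) (l : ℕ) (x y z : ℝ) :
    dR s l x z ≤ dR s l x y + dR s l y z :=
  quotDist_triangle (snow_nonneg s) (snow_self hs0) (Rel.refl l) x y z

theorem dR_eq_zero {s : ℝ} (hs0 : 0 < s) {l : ℕ} {x y : ℝ} (h : Rel l x y) : dR s l x y = 0 :=
  quotDist_eq_zero (snow_nonneg s) (snow_self hs0) (Rel.refl l) h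

theorem dR_le_dRestrict (s : ℝ) (l : ℕ) {I : Set ℝ} (x y : I) :
    dR s l x y ≤ dRestrict s l I x y := by
  refine csInf_le_csInf (itineraryLengths_bddBelow (snow_nonneg s) _ _)
    ⟨_, mem_itineraryLengths (fun z : I => Rel.refl l z) x y⟩ ?_
  rintro L ⟨n, u, v, ⟨h0, h1, h2⟩, rfl⟩
  exact ⟨n, fun k => u k, fun k => v k, ⟨h0, h1, h2⟩, rfl⟩

theorem dRestrict_triangle {s : ℝ} (hs0 : 0 < s) (l : ℕ) {I : Set ℝ} (x y z : I) :
    dRestrict s l I x z ≤ dRestrict s l I x y + dRestrict s l I y z :=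
  quotDist_triangle (d := fun a b : I => snow s a b) (R := fun a b : I => Rel l a b)
    (fun a b => snow_nonneg s a b) (fun a => snow_self hs0 a) (fun a => Rel.refl l a) x y z

theorem dRestrict_le_snow (s : ℝ) (l : ℕ) {I : Set ℝ} (x y : I) :
    dRestrict s l I x y ≤ snow s x y :=
  quotDist_le (d := fun a b : I => snow s a b) (fun a b => snow_nonneg s a b)
    (fun a => Rel.refl l a) x y

theorem dRestrict_eq_zero {s : ℝ} (hs0 : 0 < s) {l : ℕ} {I : Set ℝ} {x y : I} (h : Rel l x y) :
    dRestrict s l I x y = 0 :=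
  quotDist_eq_zero (R := fun a b : I => Rel l a b) (fun a b => snow_nonneg s a b)
    (fun a => snow_self hs0 a) (fun a => Rel.refl l a) h

theorem left_lt_right (l n : ℕ) (m : ℤ) : scale l ^ n * (m : ℝ) < scale l ^ n * (m + 1) := by
  have := pow_pos (scale_pos l) n
  linarith

/-- The ends of a cell without shortcut at the ends are at distance `μ ^ n`. -/
theorem NoShortcutAtEnds.le_dR {s : ℝ} (hs0 : 0 < s) (hs1 : s < 1) {l n : ℕ} (hl : 3 ≤ l)
    (hh : scale l ≤ 1 - s) {m : ℤ} (h : NoShortcutAtEnds l n m) :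
    ratio s l ^ n ≤ dR s l (scale l ^ n * m) (scale l ^ n * (m + 1)) := by
  refine h.good_left.le_dR hs0 hs1 hl hh h.good_right ?_
  rintro (h' | h')
  · exact h.left _ h'
  · exact (left_lt_right l n m).ne h'

theorem snow_le_of_mem_cell {s : ℝ} (hs0 : 0 < s) {l n : ℕ} {m : ℤ} {x y : ℝ}
    (hx : x ∈ cell l n m) (hy : y ∈ cell l n m) : snow s x y ≤ ratio s l ^ n := by
  rw [← scale_pow_rpow]
  refine Real.rpow_le_rpow (abs_nonneg _) ?_ hs0.le
  rw [abs_le]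
  constructor <;> linarith [hx.1, hx.2, hy.1, hy.2]

/-- An excursion out of a cell without shortcut at the ends is not shorter than the direct jump. -/
theorem NoShortcutAtEnds.snow_le_excursion {s : ℝ} (hs0 : 0 < s) (hs1 : s < 1) {l n : ℕ}
    (hl : 3 ≤ l) (hh : scale l ≤ 1 - s) {m : ℤ} (h : NoShortcutAtEnds l n m) {a b c d : ℝ}
    (ha : a ∈ cell l n m) (hb : b ∉ cell l n m) (hc : c ∉ cell l n m) (hd : d ∈ cell l n m) :
    snow s a d ≤ snow s a b + dR s l b c + snow s c d := by
  have hpq := left_lt_right l n m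
  have hdist := h.le_dR hs0 hs1 hl hh
  have had := snow_le_of_mem_cell hs0 (s := s) ha hd
  have n1 := snow_nonneg s a b
  have n2 := snow_nonneg s c d
  have n3 := dR_nonneg s l b c
  simp only [cell, mem_Icc, not_and_or, not_le] at ha hb hc hd
  set p := scale l ^ n * (m : ℝ)
  set q := scale l ^ n * ((m : ℝ) + 1)
  -- When `b` and `c` lie on the same side of the cell, one of the two jumps alone covers `|a - d|`.
  -- On opposite sides, moving `a` and `d` to the ends only shortens the jumps, and the ends are `μ
  -- ^ n` apart.
  have same : |a - d| ≤ |a - b| ∨ |a - d| ≤ |c - d| →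
      snow s a d ≤ snow s a b + dR s l b c + snow s c d := by
    rintro (h | h) <;> linarith [snow_le_snow hs0 h]
  rcases hb with hb | hb <;> rcases hc with hc | hc
  · apply same
    rw [abs_of_pos (show 0 < a - b by linarith [ha.1]),
      abs_of_neg (show c - d < 0 by linarith [hd.1])]
    rcases le_total a d with h | h
    · right; rw [abs_of_nonpos (by linarith)]; linarith [ha.1]
    · left; rw [abs_of_nonneg (by linarith)]; linarith [hd.1]
  · have h1 : snow s p b ≤ snow s a b := snow_le_snow hs0 (by
      rw [abs_of_pos (by linarith), abs_of_pos (by linarith [ha.1])]; linarith [ha.1])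
    have h2 : snow s c q ≤ snow s c d := snow_le_snow hs0 (by
      rw [abs_of_pos (by linarith), abs_of_pos (by linarith [hd.2])]; linarith [hd.2])
    linarith [dR_triangle hs0 l p b q, dR_triangle hs0 l b c q, dR_le_snow s l p b,
      dR_le_snow s l c q]
  · have h1 : snow s q b ≤ snow s a b := snow_le_snow hs0 (by
      rw [abs_of_neg (by linarith), abs_of_neg (by linarith [ha.2])]; linarith [ha.2])
    have h2 : snow s c p ≤ snow s c d := snow_le_snow hs0 (by
      rw [abs_of_neg (by linarith), abs_of_neg (by linarith [hd.1])]; linarith [hd.1])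
    rw [dR_comm] at hdist
    linarith [dR_triangle hs0 l q b p, dR_triangle hs0 l b c p, dR_le_snow s l q b,
      dR_le_snow s l c p]
  · apply same
    rw [abs_of_neg (show a - b < 0 by linarith [ha.2]),
      abs_of_pos (show 0 < c - d by linarith [hd.2])]
    rcases le_total a d with h | h
    · left; rw [abs_of_nonpos (by linarith)]; linarith [hd.2]
    · right; rw [abs_of_nonneg (by linarith)]; linarith [ha.2]

/-- Shortcuts do not cross the boundary of the cell, so excursions begin and end with jumps. While
outside, the invariant remembers the exit jump from `a` to `b`; on return, `snow_le_excursion`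
replaces the excursion by one jump. -/
theorem NoShortcutAtEnds.dR_eq_dRestrict {s : ℝ} (hs0 : 0 < s) (hs1 : s < 1) {l n : ℕ}
    (hl : 3 ≤ l) (hh : scale l ≤ 1 - s) {m : ℤ} (h : NoShortcutAtEnds l n m)
    (x y : cell l n m) : dR s l x y = dRestrict s l (cell l n m) x y := by
  refine le_antisymm (dR_le_dRestrict s l x y) (le_quotDist (Rel.refl l) fun L hL => ?_)
  set ρ := dRestrict s l (cell l n m)
  have tri : ∀ a b, ρ x b ≤ ρ x a + snow s a b := fun a b =>
    (dRestrict_triangle hs0 l x a b).trans (add_le_add le_rfl (dRestrict_le_snow s l a b))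
  have key : ∀ z L, Reach (snow s) (Rel l) x z L →
      (∃ hz : z ∈ cell l n m, ρ x ⟨z, hz⟩ ≤ L) ∨
      (z ∉ cell l n m ∧ ∃ a : cell l n m, ∃ b, b ∉ cell l n m ∧
        ρ x a + snow s a b + dR s l b z ≤ L) := by
    intro z L hL
    induction hL with
    | refl => exact Or.inl ⟨x.2, (dRestrict_eq_zero hs0 (Rel.refl l _)).le⟩
    | @jump z L w _ ih =>
      rcases ih with ⟨hz, h1⟩ | ⟨hz, a, b, hb, h1⟩ <;> by_cases hw : w ∈ cell l n m
      · exact Or.inl ⟨hw, (tri ⟨z, hz⟩ ⟨w, hw⟩).trans (by simpa using h1)⟩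
      · exact Or.inr ⟨hw, ⟨z, hz⟩, w, hw, by
          rw [dR_eq_zero hs0 (Rel.refl l w)]; linarith⟩
      · exact Or.inl ⟨hw, (tri a ⟨w, hw⟩).trans (by
          linarith [h.snow_le_excursion hs0 hs1 hl hh a.2 hb hz hw])⟩
      · exact Or.inr ⟨hw, a, b, hb, by
          linarith [dR_triangle hs0 l b z w, dR_le_snow s l z w]⟩
    | @cut z w L _ hzw ih =>
      obtain hzw' | rfl := hzw
      · rcases ih with ⟨hz, h1⟩ | ⟨hz, a, b, hb, h1⟩
        · have hw := h.mem_of_shortcut hl hz hzw'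
          refine Or.inl ⟨hw, ?_⟩
          have h2 := dRestrict_triangle hs0 (s := s) l x ⟨z, hz⟩ ⟨w, hw⟩
          rw [dRestrict_eq_zero hs0 (x := ⟨z, hz⟩) (y := ⟨w, hw⟩) (Or.inl hzw')] at h2
          exact h2.trans (by simpa using h1)
        · have hw : w ∉ cell l n m := fun hw => hz (h.mem_of_shortcut hl hw (shortcuts_symm hzw'))
          refine Or.inr ⟨hw, a, b, hb, ?_⟩
          have := dR_eq_zero hs0 (s := s) (l := l) (Or.inl hzw')
          linarith [dR_triangle hs0 l b z w]
      · exact ih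
  rcases key y L hL with ⟨_, h1⟩ | ⟨hy, -⟩
  · exact h1
  · exact (hy y.2).elim

theorem snow_cellMap {s : ℝ} (l n : ℕ) (m : ℤ) (n' : ℕ) (m' : ℤ) (x y : ℝ) :
    snow s (cellMap l n m n' m' x) (cellMap l n m n' m' y) =
      ratio s l ^ ((n' : ℤ) - n) * snow s x y := by
  have hp : 0 < scale l ^ ((n' : ℤ) - n) := zpow_pos (scale_pos l) _
  have e : cellMap l n m n' m' x - cellMap l n m n' m' y =
      scale l ^ ((n' : ℤ) - n) * (x - y) := by unfold cellMap; ring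
  rw [snow, e, abs_mul, abs_of_pos hp, Real.mul_rpow hp.le (abs_nonneg _), snow, ratio]
  congr 1
  rw [← Real.rpow_intCast, ← Real.rpow_intCast, ← Real.rpow_mul (scale_pos l).le,
    ← Real.rpow_mul (scale_pos l).le, mul_comm]

theorem ratio_pos (s : ℝ) (l : ℕ) : 0 < ratio s l := Real.rpow_pos_of_pos (scale_pos l) s

/-- Itineraries may be taken inside the source cell, where `cellMap` carries shortcuts to shortcuts.
The target cell needs no hypothesis here; it serves for the inverse map. -/
theorem NoShortcutAtEnds.dR_cellMap_le {s : ℝ} (hs0 : 0 < s) (hs1 : s < 1) {l n : ℕ}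
    (hl : 3 ≤ l) (hh : scale l ≤ 1 - s) {m : ℤ} (h : NoShortcutAtEnds l n m) (n' : ℕ) (m' : ℤ)
    {x y : ℝ} (hx : x ∈ cell l n m) (hy : y ∈ cell l n m) :
    dR s l (cellMap l n m n' m' x) (cellMap l n m n' m' y) ≤
      ratio s l ^ ((n' : ℤ) - n) * dR s l x y := by
  have hp : 0 < ratio s l ^ ((n' : ℤ) - n) := zpow_pos (ratio_pos s l) _
  have := h.dR_eq_dRestrict hs0 hs1 hl hh ⟨x, hx⟩ ⟨y, hy⟩
  simp only at this
  rw [this, ← div_le_iff₀' hp]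
  refine le_csInf ⟨_, mem_itineraryLengths (fun z : cell l n m => Rel.refl l z) _ _⟩ ?_
  rintro L ⟨N, u, v, ⟨h0, h1, h2⟩, rfl⟩
  rw [div_le_iff₀' hp]
  refine csInf_le (itineraryLengths_bddBelow (snow_nonneg s) _ _) ⟨N, fun k =>
    cellMap l n m n' m' (u k), fun k => cellMap l n m n' m' (v k), ⟨?_, ?_, ?_⟩, ?_⟩
  · exact h.rel_cellMap hl n' m' hx (u 0).2 h0
  · exact fun k hk => h.rel_cellMap hl n' m' (v k).2 (u (k + 1)).2 (h1 k hk)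
  · exact h.rel_cellMap hl n' m' (v N).2 hy h2
  · simp only [snow_cellMap, Finset.mul_sum]

theorem NoShortcutAtEnds.dR_cellMap {s : ℝ} (hs0 : 0 < s) (hs1 : s < 1) {l n n' : ℕ}
    (hl : 3 ≤ l) (hh : scale l ≤ 1 - s) {m m' : ℤ} (h : NoShortcutAtEnds l n m)
    (h' : NoShortcutAtEnds l n' m') {x y : ℝ} (hx : x ∈ cell l n m) (hy : y ∈ cell l n m) :
    dR s l (cellMap l n m n' m' x) (cellMap l n m n' m' y) =
      ratio s l ^ ((n' : ℤ) - n) * dR s l x y := by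
  refine le_antisymm (h.dR_cellMap_le hs0 hs1 hl hh n' m' hx hy) ?_
  have h1 := h'.dR_cellMap_le hs0 hs1 hl hh n m (cellMap_mapsTo l n m n' m' hx)
    (cellMap_mapsTo l n m n' m' hy)
  rw [cellMap_cellMap, cellMap_cellMap] at h1
  have hp : 0 < ratio s l ^ ((n' : ℤ) - n) := zpow_pos (ratio_pos s l) _
  have h2 := mul_le_mul_of_nonneg_left h1 hp.le
  rwa [← mul_assoc, ← zpow_add₀ (ratio_pos s l).ne', show (n' : ℤ) - n + (n - n') = 0 by ring,
    zpow_zero, one_mul] at h2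

theorem noShortcutAtEnds_zero {l : ℕ} (hl : 3 ≤ l) (m : ℤ) : NoShortcutAtEnds l 0 m := by
  have key : ∀ (i : ℤ) (x : ℝ), (scale l ^ 0 * (i : ℝ), x) ∉ shortcuts l := by
    intro i x h
    obtain ⟨k, h | h⟩ := mem_shortcuts.1 h
    · have := h.level_le_left rfl; omega
    · have := h.level_le_right hl rfl; omega
  refine fun x => ⟨key m x, fun h => key (m + 1) x ?_⟩
  push_cast
  exact shortcuts_symm h

theorem cell_zero (l : ℕ) : cell l 0 0 = Icc 0 1 := by simp [cell]

/-! ### The Lebesgue measure of the balls -/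

theorem exists_mem_cell (l n : ℕ) (x : ℝ) : ∃ m : ℤ, x ∈ cell l n m := by
  have hp : 0 < scale l ^ n := pow_pos (scale_pos l) n
  refine ⟨⌊x / scale l ^ n⌋, ?_, ?_⟩
  · rw [← le_div_iff₀' hp]; exact Int.floor_le _
  · rw [← div_le_iff₀' hp]; exact (Int.lt_floor_add_one _).le

/-- A jump out of the cell may be stopped at the end it passes over, at no greater cost; a shortcut
leaves only from an end. -/
theorem Reach.exit {s : ℝ} (hs0 : 0 < s) {l n : ℕ} (hl : 3 ≤ l) {m : ℤ} {x z L : ℝ}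
    (hx : x ∈ cell l n m) (h : Reach (snow s) (Rel l) x z L) :
    z ∈ cell l n m ∨ ∃ g, (g = scale l ^ n * m ∨ g = scale l ^ n * (m + 1)) ∧ dR s l x g ≤ L := by
  induction h with
  | refl => exact Or.inl hx
  | @jump z L w hL ih =>
    rcases ih with hz | ⟨g, hg, h⟩
    · by_cases hw : w ∈ cell l n m
      · exact Or.inl hw
      · right
        have h1 : dR s l x z ≤ L := hL.quotDist_le (snow_nonneg s) (snow_self hs0) (Rel.refl l)
        have key : ∀ g, |z - g| ≤ |z - w| → dR s l x g ≤ L + snow s z w := fun g hg => by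
          linarith [dR_triangle hs0 l x z g, dR_le_snow s l z g, snow_le_snow hs0 hg]
        simp only [cell, mem_Icc, not_and_or, not_le] at hz hw
        rcases hw with hw | hw
        · refine ⟨_, Or.inl rfl, key _ ?_⟩
          rw [abs_of_nonneg (by linarith [hz.1]), abs_of_pos (by linarith [hz.1])]
          linarith
        · refine ⟨_, Or.inr rfl, key _ ?_⟩
          rw [abs_of_nonpos (by linarith [hz.2]), abs_of_neg (by linarith [hz.2])]
          linarith
    · exact Or.inr ⟨g, hg, by linarith [snow_nonneg s z w]⟩
  | @cut z w L hL hzw ih =>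
    rcases ih with hz | h
    · obtain hzw | rfl := hzw
      · by_cases hw : w ∈ cell l n m
        · exact Or.inl hw
        · exact Or.inr ⟨z, shortcut_exit hl hz hw hzw,
            hL.quotDist_le (snow_nonneg s) (snow_self hs0) (Rel.refl l)⟩
      · exact Or.inl hz
    · exact Or.inr h

theorem exists_end_of_dR_lt {s : ℝ} (hs0 : 0 < s) {l n : ℕ} (hl : 3 ≤ l) {m : ℤ} {x u r : ℝ}
    (hx : x ∈ cell l n m) (hu : u ∉ cell l n m) (h : dR s l x u < r) :
    ∃ g, (g = scale l ^ n * m ∨ g = scale l ^ n * (m + 1)) ∧ dR s l x g < r := by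
  obtain ⟨L, hL, h⟩ := exists_reach_lt (Rel.refl l) h
  rcases h.exit hs0 hl hx with h | ⟨g, hg, h⟩
  · exact (hu h).elim
  · exact ⟨g, hg, h.trans_lt hL⟩

/-- If `x` and `u` share no cell, ends `g`, `g'` of their cells lie within `r` of them, so `g` and
`g'` are less than `3 r ≤ μ ^ (n + 1)` apart. Being good of level `n + 1`, they are identified: `u`
is within `h ^ n` of an end of the cell of `x` or of its partner. The total length is `3 + 2 + 2 =
7` steps. -/
theorem volume_setOf_dR_lt_le {s : ℝ} (hs0 : 0 < s) (hs1 : s < 1) {l : ℕ} (hl : 3 ≤ l)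
    (hh : scale l ≤ 1 - s) (n : ℕ) (x : ℝ) {r : ℝ} (hr : 3 * r ≤ ratio s l ^ (n + 1)) :
    volume {u | dR s l x u < r} ≤ ENNReal.ofReal (7 * scale l ^ n) := by
  obtain ⟨m, hx⟩ := exists_mem_cell l n x
  set w := scale l ^ n with hw
  have hp : 0 < w := pow_pos (scale_pos l) n
  obtain ⟨p', hp'⟩ := exists_partner hl (w * m)
  obtain ⟨q', hq'⟩ := exists_partner hl (w * (m + 1))
  have hsub : {u | dR s l x u < r} ⊆ (Icc (w * m - w) (w * (m + 1) + w) ∪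
      Icc (p' - w) (p' + w)) ∪ Icc (q' - w) (q' + w) := by
    intro u hu
    simp only [mem_union, mem_Icc]
    have hpq := left_lt_right l n m
    by_cases hum : u ∈ cell l n m
    · left; left; constructor <;> linarith [hum.1, hum.2]
    obtain ⟨g, hg, hxg⟩ := exists_end_of_dR_lt hs0 hl hx hum hu
    obtain ⟨m', hu'⟩ := exists_mem_cell l n u
    by_cases hx' : x ∈ cell l n m'
    · left; left
      constructor <;> linarith [hu'.1, hu'.2, hx.1, hx.2, hx'.1, hx'.2]
    obtain ⟨g', hg', hug⟩ := exists_end_of_dR_lt hs0 hl hu' hx' ((dR_comm s l u x).trans_lt hu)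
    have hug' : g' - w ≤ u ∧ u ≤ g' + w := by
      have h1 := hu'.1
      have h2 := hu'.2
      rw [← hw] at h1 h2
      rcases hg' with rfl | rfl <;> constructor <;> linarith
    have hrel : Rel l g g' := by
      by_contra hcon
      have hgg : Good l (n + 1) g := good_of_mem_grid hl n.lt_succ_self
        (hg.elim (fun h => ⟨m, h⟩) fun h => ⟨m + 1, by rw [h]; push_cast; rfl⟩)
      have hgg' : Good l (n + 1) g' := good_of_mem_grid hl n.lt_succ_self
        (hg'.elim (fun h => ⟨m', h⟩) fun h => ⟨m' + 1, by rw [h]; push_cast; rfl⟩)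
      have h1 := hgg.le_dR hs0 hs1 hl hh hgg' hcon
      have h2 : dR s l x u < r := hu
      rw [dR_comm] at hxg
      linarith [dR_triangle hs0 l g x g', dR_triangle hs0 l x u g']
    rcases hg with rfl | rfl
    · rcases hp' _ hrel with rfl | rfl
      · left; left; constructor <;> linarith [hug'.1, hug'.2]
      · left; right; exact hug'
    · rcases hq' _ hrel with rfl | rfl
      · left; left; constructor <;> linarith [hug'.1, hug'.2]
      · right; exact hug'
  refine (measure_mono hsub).trans ((measure_union_le _ _).trans
    ((add_le_add (measure_union_le _ _) le_rfl).trans ?_))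
  rw [Real.volume_Icc, Real.volume_Icc, Real.volume_Icc, ← ENNReal.ofReal_add (by linarith)
    (by linarith), ← ENNReal.ofReal_add (by linarith) (by linarith)]
  exact ENNReal.ofReal_le_ofReal (by linarith)

theorem ratio_lt_one {s : ℝ} (hs0 : 0 < s) {l : ℕ} (hl : 3 ≤ l) : ratio s l < 1 :=
  Real.rpow_lt_one (scale_pos l).le (by linarith [scale_le hl]) hs0

theorem ratio_pow_rpow_inv {s : ℝ} (hs0 : 0 < s) (l n : ℕ) :
    (ratio s l ^ n) ^ (1 / s) = scale l ^ n := by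
  rw [← scale_pow_rpow, ← Real.rpow_mul (pow_pos (scale_pos l) n).le, mul_one_div_cancel hs0.ne',
    Real.rpow_one]

/-- The balls of radius `r` have Lebesgue measure at most a multiple of `r ^ (1 / s)`. -/
theorem exists_volume_le {s : ℝ} (hs0 : 0 < s) (hs1 : s < 1) {l : ℕ} (hl : 3 ≤ l)
    (hh : scale l ≤ 1 - s) : ∃ C : ℝ, 0 < C ∧ ∀ (x r : ℝ), 0 < r →
      volume {u | u ∈ Icc (0 : ℝ) 1 ∧ dR s l x u < r} ≤ ENNReal.ofReal (C * r ^ (1 / s)) := by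
  have h0 := scale_pos l
  have hs8 := scale_le hl
  have hμ := ratio_pos s l
  refine ⟨7 / scale l ^ 2 * 3 ^ (1 / s), by positivity, fun x r hr => ?_⟩
  have h3 : (3 * r) ^ (1 / s) = 3 ^ (1 / s) * r ^ (1 / s) :=
    Real.mul_rpow (by norm_num) hr.le
  rw [mul_assoc, ← h3]
  rcases le_or_gt (3 * r) (ratio s l) with hr' | hr'
  -- This selects `n` with `μ ^ (n + 2) < 3 r ≤ μ ^ (n + 1)`; the loss of two levels is the factor
  -- `h ^ (-2)` in the constant.
  · obtain ⟨n, hn1, hn2⟩ := exists_nat_pow_near_of_lt_one (x := 3 * r / ratio s l) (by positivity)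
      (by rwa [div_le_one hμ]) hμ (ratio_lt_one hs0 hl)
    rw [lt_div_iff₀ hμ, ← pow_succ] at hn1
    rw [div_le_iff₀ hμ, ← pow_succ] at hn2
    refine (measure_mono fun u hu => hu.2).trans
      ((volume_setOf_dR_lt_le hs0 hs1 hl hh n x hn2).trans (ENNReal.ofReal_le_ofReal ?_))
    have h4 : scale l ^ (n + 2) ≤ (3 * r) ^ (1 / s) := by
      rw [← ratio_pow_rpow_inv hs0]
      exact Real.rpow_le_rpow (by positivity) hn1.le (by positivity)
    calc 7 * scale l ^ n = 7 / scale l ^ 2 * scale l ^ (n + 2) := by rw [pow_add]; field_simp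
      _ ≤ _ := by gcongr
  · refine (measure_mono fun u hu => hu.1).trans ?_
    rw [Real.volume_Icc]
    refine ENNReal.ofReal_le_ofReal ?_
    have h4 : scale l ^ 1 ≤ (3 * r) ^ (1 / s) := by
      rw [← ratio_pow_rpow_inv hs0]
      exact Real.rpow_le_rpow (by positivity) (by rw [pow_one]; exact hr'.le) (by positivity)
    calc (1 : ℝ) - 0 ≤ 7 / scale l := by rw [le_div_iff₀ h0]; linarith
      _ = 7 / scale l ^ 2 * scale l ^ 1 := by field_simp
      _ ≤ _ := by gcongr

/-! ### Cells in balls -/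

/-- Write `2 ^ l = 2 M` with `M ≥ 4`. On the grid of step `h ^ (k + 2)`, shortcut ends have index
`0` (coarser grid), `M` (left ends of level `k + 2`) or `1` (right ends of level `k + 1`) modulo `2
M`. The residues `2` and `3` avoid them, even modulo `M`. -/
theorem noShortcutAtEnds_of_mod {l : ℕ} (hl : 3 ≤ l) (k : ℕ) (j : ℤ) :
    NoShortcutAtEnds l (k + 2) (2 ^ l * j + 2) := by
  have hp : 0 < scale l ^ (k + 2) := pow_pos (scale_pos l) _
  obtain ⟨M, hM4, hM⟩ : ∃ M : ℤ, 4 ≤ M ∧ (2 : ℤ) ^ l = 2 * M := by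
    obtain ⟨i, rfl⟩ := Nat.exists_eq_add_of_le' hl
    refine ⟨2 ^ i * 4, ?_, by rw [pow_add]; ring⟩
    have : (0 : ℤ) < 2 ^ i := by positivity
    omega
  have hk1 : scale l ^ (k + 1) = scale l ^ (k + 2) * ((2 * M : ℤ) : ℝ) := by
    have := scale_pow_eq_mul (l := l) (show k + 1 ≤ k + 2 by omega)
    rwa [show k + 2 - (k + 1) = 1 by omega, mul_one, hM] at this
  have cancel : ∀ a b : ℤ, scale l ^ (k + 2) * (a : ℝ) = scale l ^ (k + 2) * b → a = b :=
    fun a b h => by exact_mod_cast mul_left_cancel₀ hp.ne' h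
  have hndvd : ∀ t : ℤ, 0 < t → t < 4 → ¬ M ∣ t := fun t h1 h2 h3 => by
    have := Int.le_of_dvd h1 h3
    omega
  have key : ∀ (t : ℤ) (x : ℝ), t = 2 ∨ t = 3 →
      (scale l ^ (k + 2) * ((2 ^ l * j + t : ℤ) : ℝ), x) ∉ shortcuts l := by
    intro t x ht h
    rw [hM] at h
    have ht1 := hndvd t (by omega) (by omega)
    have ht2 := hndvd (t - 1) (by omega) (by omega)
    have grid : ∀ i : ℤ, scale l ^ (k + 2) * ((2 * M * j + t : ℤ) : ℝ) = scale l ^ (k + 1) * i →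
        False := by
      intro i hi
      have := cancel (2 * M * j + t) (2 * M * i) (by rw [hi, hk1]; push_cast; ring)
      exact ht1 ⟨2 * i - 2 * j, by linear_combination this⟩
    obtain ⟨k', h | h⟩ := mem_shortcuts.1 h
    · have h1 := h.level_le_left rfl
      rcases Nat.lt_or_ge k' (k + 1) with h2 | h2
      · obtain ⟨i, hi⟩ := h.left_mem hl h2
        exact grid i hi
      · obtain rfl : k' = k + 1 := by omega
        obtain ⟨i, hi, -⟩ := h
        rw [hk1] at hi
        refine ht1 ⟨2 * i + 1 - 2 * j, ?_⟩
        have := cancel (2 * M * j + t) (2 * M * i + M) (by rw [hi]; push_cast; ring)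
        linear_combination this
    · have h1 := h.level_le_right hl rfl
      rcases Nat.lt_or_ge k' k with h2 | h2
      · obtain ⟨i, hi⟩ := h.right_mem hl (show k' + 2 ≤ k + 1 by omega)
        exact grid i hi
      · obtain rfl : k' = k := by omega
        obtain ⟨i, hi⟩ := h.left_mem hl le_rfl
        obtain ⟨-, -, h⟩ := h
        rw [hi, hk1] at h
        refine ht2 ⟨2 * i - 2 * j, ?_⟩
        have := cancel (2 * M * j + t) (2 * M * i + 1) (by rw [h]; push_cast; ring)
        linear_combination this
  intro x
  refine ⟨key 2 x (Or.inl rfl), fun h => key 3 x (Or.inr rfl) ?_⟩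
  convert shortcuts_symm h using 3
  push_cast; ring

theorem exists_cell_in_unit (l n : ℕ) {x : ℝ} (hx : x ∈ Icc (0 : ℝ) 1) :
    ∃ j : ℤ, x ∈ cell l n j ∧ 0 ≤ j ∧ scale l ^ n * ((j : ℝ) + 1) ≤ 1 := by
  have hp : 0 < scale l ^ n := pow_pos (scale_pos l) n
  have e := scale_pow_eq_mul (l := l) (Nat.zero_le n)
  rw [pow_zero, Nat.sub_zero] at e
  set W : ℤ := 2 ^ (l * n)
  have hW : 0 < W := by positivity
  rcases hx.2.eq_or_lt with rfl | hx1
  · refine ⟨W - 1, ⟨?_, ?_⟩, by omega, ?_⟩ <;> push_cast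
    · nlinarith
    · rw [sub_add_cancel]; exact e.le
    · rw [sub_add_cancel]; exact e.ge
  · obtain ⟨m, hm⟩ := exists_mem_cell l n x
    by_cases hm0 : m < 0
    · have h1 : (m : ℝ) + 1 ≤ 0 := by exact_mod_cast Int.add_one_le_iff.2 hm0
      have h2 : x ≤ 0 := hm.2.trans (mul_nonpos_of_nonneg_of_nonpos hp.le h1)
      obtain rfl : x = 0 := le_antisymm h2 hx.1
      refine ⟨0, ⟨by simp, by simpa using hp.le⟩, le_rfl, ?_⟩
      have : (1 : ℝ) ≤ W := by exact_mod_cast hW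
      push_cast
      nlinarith
    · refine ⟨m, hm, not_lt.1 hm0, ?_⟩
      refine (mul_le_mul_of_nonneg_left ?_ hp.le).trans e.ge
      have h1 : (m : ℝ) < W := by
        refine lt_of_mul_lt_mul_left ?_ hp.le
        rw [← e]
        exact hm.1.trans_lt hx1
      exact_mod_cast h1

/-- Every ball contains a cell without shortcut at the ends, of comparable size. -/
theorem exists_cell_in_ball {s : ℝ} (hs0 : 0 < s) {l : ℕ} (hl : 3 ≤ l) {x r : ℝ}
    (hx : x ∈ Icc (0 : ℝ) 1) (hr0 : 0 < r) (hr1 : r ≤ 1) :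
    ∃ (n : ℕ) (m : ℤ), NoShortcutAtEnds l n m ∧ cell l n m ⊆ Icc 0 1 ∧
      (∀ u ∈ cell l n m, dR s l x u < r) ∧
      ratio s l ^ 2 * r ≤ ratio s l ^ n ∧ ratio s l ^ n ≤ ratio s l * r := by
  have hμ := ratio_pos s l
  -- Here `μ ^ (k + 1) < r ≤ μ ^ k`: a cell of level `k + 1` around `x` lies in the ball, and its
  -- third subcell has no shortcut at its ends.
  obtain ⟨k, hk1, hk2⟩ := exists_nat_pow_near_of_lt_one hr0 hr1 hμ (ratio_lt_one hs0 hl)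
  obtain ⟨j, hj, hj0, hj1⟩ := exists_cell_in_unit l (k + 1) hx
  have hp : 0 < scale l ^ (k + 2) := pow_pos (scale_pos l) _
  have e : scale l ^ (k + 1) = scale l ^ (k + 2) * 2 ^ l := by
    rw [pow_succ _ (k + 1), mul_assoc, scale_mul_two_pow, mul_one]
  have h8 : (8 : ℝ) ≤ 2 ^ l := by
    calc (8 : ℝ) = 2 ^ 3 := by norm_num
      _ ≤ 2 ^ l := pow_le_pow_right₀ (by norm_num) hl
  have hsub : cell l (k + 2) (2 ^ l * j + 2) ⊆ cell l (k + 1) j := by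
    rintro u ⟨h1, h2⟩
    push_cast at h1 h2
    constructor
    · refine le_trans ?_ h1
      rw [e, mul_assoc]
      gcongr
      linarith
    · refine h2.trans ?_
      rw [e, mul_assoc]
      gcongr
      linarith
  refine ⟨k + 2, 2 ^ l * j + 2, noShortcutAtEnds_of_mod hl k j, ?_, ?_, ?_, ?_⟩
  · intro u hu
    have hu := hsub hu
    refine ⟨le_trans ?_ hu.1, hu.2.trans hj1⟩
    have : (0 : ℝ) ≤ j := by exact_mod_cast hj0
    have := pow_pos (scale_pos l) (k + 1)
    positivity
  · intro u hu
    exact ((dR_le_snow s l x u).trans (snow_le_of_mem_cell hs0 hj (hsub hu))).trans_lt hk1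
  · rw [pow_add, mul_comm]
    gcongr
  · rw [pow_succ' _ (k + 1)]
    gcongr

/-! ### The quotient space -/

section

variable {s : ℝ} {hs0 : 0 < s} {l : ℕ}

theorem exists_proj_eq (z : Quot01 s hs0 l) : ∃ x : Icc (0 : ℝ) 1, proj s hs0 l x = z :=
  SeparationQuotient.surjective_mk z

theorem snow_le_one {x y : ℝ} (hs0 : 0 < s) (hx : x ∈ Icc (0 : ℝ) 1) (hy : y ∈ Icc (0 : ℝ) 1) :
    snow s x y ≤ 1 :=
  Real.rpow_le_one (abs_nonneg _)
    (abs_le.2 ⟨by linarith [hx.1, hy.2], by linarith [hx.2, hy.1]⟩) hs0.le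

theorem dist_le_one (z w : Quot01 s hs0 l) : dist z w ≤ 1 := by
  obtain ⟨x, rfl⟩ := exists_proj_eq z
  obtain ⟨y, rfl⟩ := exists_proj_eq w
  rw [dist_proj]
  exact (dR_le_snow s l x y).trans (snow_le_one hs0 x.2 y.2)

theorem IsRadius.le_one {r : ℝ} (h : IsRadius (Quot01 s hs0 l) r) : r ≤ 1 := by
  have h1 : Metric.ediam (univ : Set (Quot01 s hs0 l)) ≤ ENNReal.ofReal 1 :=
    Metric.ediam_le fun z _ w _ => by
      rw [edist_dist]; exact ENNReal.ofReal_le_ofReal (dist_le_one z w)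
  exact (ENNReal.ofReal_le_ofReal_iff zero_le_one).1 (h.2.trans h1)

theorem continuous_proj : Continuous (proj s hs0 l) := by
  rw [Metric.continuous_iff]
  intro y ε hε
  refine ⟨ε ^ (1 / s), by positivity, fun x hx => ?_⟩
  rw [dist_proj]
  refine (dR_le_snow s l x y).trans_lt ?_
  rw [Subtype.dist_eq, Real.dist_eq] at hx
  calc snow s x y < (ε ^ (1 / s)) ^ s := Real.rpow_lt_rpow (abs_nonneg _) hx hs0
    _ = ε := by rw [← Real.rpow_mul hε.le, one_div_mul_cancel hs0.ne', Real.rpow_one]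

instance : CompactSpace (Quot01 s hs0 l) := by
  refine ⟨?_⟩
  rw [← (show Function.Surjective (proj s hs0 l) from exists_proj_eq).range_eq]
  exact isCompact_range continuous_proj

/-- The projection, extended to the line by its values at the ends of `[0, 1]`. -/
def projLine (s : ℝ) (hs0 : 0 < s) (l : ℕ) (u : ℝ) : Quot01 s hs0 l :=
  proj s hs0 l (projIcc 0 1 zero_le_one u)

theorem projLine_of_mem {u : ℝ} (hu : u ∈ Icc (0 : ℝ) 1) :
    projLine s hs0 l u = proj s hs0 l ⟨u, hu⟩ := by
  rw [projLine, projIcc_of_mem _ hu]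

theorem dist_projLine {u v : ℝ} (hu : u ∈ Icc (0 : ℝ) 1) (hv : v ∈ Icc (0 : ℝ) 1) :
    dist (projLine s hs0 l u) (projLine s hs0 l v) = dR s l u v := by
  rw [projLine_of_mem hu, projLine_of_mem hv, dist_proj]

theorem continuous_projLine : Continuous (projLine s hs0 l) :=
  continuous_proj.comp continuous_projIcc

theorem exists_projLine_eq (z : Quot01 s hs0 l) : ∃ x ∈ Icc (0 : ℝ) 1, projLine s hs0 l x = z := by
  obtain ⟨x, rfl⟩ := exists_proj_eq z
  exact ⟨x, x.2, projLine_of_mem x.2⟩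

theorem proj_image_eq {S : Set ℝ} (hS : S ⊆ Icc 0 1) :
    proj s hs0 l '' {u | (u : ℝ) ∈ S} = projLine s hs0 l '' S := by
  ext z
  constructor
  · rintro ⟨u, hu, rfl⟩
    exact ⟨u, hu, projLine_of_mem u.2⟩
  · rintro ⟨u, hu, rfl⟩
    exact ⟨⟨u, hS hu⟩, hu, (projLine_of_mem (hS hu)).symm⟩

theorem hausdorff_mono {X : Type*} [MetricSpace X] {α : ℝ} {A B : Set X} (h : A ⊆ B) :
    hausdorff α A ≤ hausdorff α B := measure_mono h

/-- The projection is `s`-Hölder with constant `1`, because `dR ≤ snow`, and one-dimensional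
Hausdorff measure on the line is Lebesgue measure. -/
theorem hausdorff_projLine_le {S : Set ℝ} (hS : S ⊆ Icc 0 1) :
    hausdorff (1 / s) (projLine s hs0 l '' S) ≤ volume S := by
  let _ : MeasurableSpace (Quot01 s hs0 l) := borel _
  have _ : BorelSpace (Quot01 s hs0 l) := ⟨rfl⟩
  have h : HolderOnWith 1 (NNReal.mk s hs0.le) (projLine s hs0 l) S := by
    intro u hu v hv
    rw [ENNReal.coe_one, one_mul, edist_dist, edist_dist, dist_projLine (hS hu) (hS hv),
      ENNReal.ofReal_rpow_of_nonneg dist_nonneg (NNReal.coe_nonneg _)]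
    exact ENNReal.ofReal_le_ofReal (dR_le_snow s l u v)
  have h1 := h.hausdorffMeasure_image_le (d := 1 / s) (show 0 < NNReal.mk s hs0.le from hs0)
    (by positivity)
  rw [ENNReal.coe_one, ENNReal.one_rpow, one_mul] at h1
  refine h1.trans_eq ?_
  rw [NNReal.coe_mk, mul_one_div_cancel hs0.ne', hausdorffMeasure_real]

/-- The second bound is the mass distribution principle for the push-forward `ν` of Lebesgue measure
on `[0, 1]`: `ν A ≤ C * diam A ^ (1 / s)` for every `A` gives `ν ≤ C * ℋ`. -/
theorem exists_hausdorff_bounds (hs0 : 0 < s) (hs1 : s < 1) (hl : 3 ≤ l)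
    (hh : scale l ≤ 1 - s) : ∃ C : ℝ, 0 < C ∧
      (∀ (z : Quot01 s hs0 l) (r : ℝ), 0 < r →
        hausdorff (1 / s) (Metric.ball z r) ≤ ENNReal.ofReal (C * r ^ (1 / s))) ∧
      ∀ S ⊆ Icc (0 : ℝ) 1,
        volume S ≤ ENNReal.ofReal C * hausdorff (1 / s) (projLine s hs0 l '' S) := by
  obtain ⟨C, hC, hvol⟩ := exists_volume_le hs0 hs1 hl hh
  have hpre : ∀ (x : ℝ) (r : ℝ), x ∈ Icc (0 : ℝ) 1 →
      projLine s hs0 l ⁻¹' Metric.ball (projLine s hs0 l x) r ∩ Icc 0 1 =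
        {u | u ∈ Icc (0 : ℝ) 1 ∧ dR s l x u < r} := by
    intro x r hx
    ext u
    rw [mem_inter_iff, and_comm]
    refine and_congr_right fun hu => ?_
    rw [mem_preimage, Metric.mem_ball, dist_projLine hu hx, dR_comm]
  refine ⟨C, hC, fun z r hr => ?_, fun S hS => ?_⟩
  · obtain ⟨x, hx, rfl⟩ := exists_projLine_eq z
    refine le_trans (hausdorff_mono ?_)
      ((hausdorff_projLine_le (hs0 := hs0) (l := l) fun u hu => hu.1).trans (hvol x r hr))
    rw [← hpre x r hx]
    intro w hw
    obtain ⟨u, hu, rfl⟩ := exists_projLine_eq w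
    exact ⟨u, ⟨hw, hu⟩, rfl⟩
  · let _ : MeasurableSpace (Quot01 s hs0 l) := borel _
    have _ : BorelSpace (Quot01 s hs0 l) := ⟨rfl⟩
    have hmeas : Measurable (projLine s hs0 l) := continuous_projLine.measurable
    set ν := (volume.restrict (Icc (0 : ℝ) 1)).map (projLine s hs0 l) with hν
    have hball : ∀ (x r : ℝ), x ∈ Icc (0 : ℝ) 1 → 0 < r →
        ν (Metric.ball (projLine s hs0 l x) r) ≤ ENNReal.ofReal (C * r ^ (1 / s)) := by
      intro x r hx hr
      rw [hν, Measure.map_apply hmeas Metric.isOpen_ball.measurableSet,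
        Measure.restrict_apply' measurableSet_Icc, hpre x r hx]
      exact hvol x r hr
    have hC0 : ENNReal.ofReal C ≠ 0 := by simpa using hC
    have hdiam : ∀ A : Set (Quot01 s hs0 l), ν A ≤ ENNReal.ofReal C * Metric.ediam A ^ (1 / s) := by
      intro A
      rcases A.eq_empty_or_nonempty with rfl | ⟨z, hz⟩
      · simp
      have hbd : Bornology.IsBounded A := Metric.isBounded_of_compactSpace
      -- Open balls need a radius above the diameter; letting it decrease to the diameter also
      -- handles sets of diameter `0`.
      have h1 : ∀ r > Metric.diam A, ν A ≤ ENNReal.ofReal (C * r ^ (1 / s)) := by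
        intro r hr
        obtain ⟨x, hx, rfl⟩ := exists_projLine_eq z
        refine (measure_mono fun w hw => ?_).trans (hball x r hx (Metric.diam_nonneg.trans_lt hr))
        exact (Metric.dist_le_diam_of_mem hbd hw hz).trans_lt hr
      have hcont : Continuous fun r : ℝ => ENNReal.ofReal (C * r ^ (1 / s)) :=
        ENNReal.continuous_ofReal.comp
          (continuous_const.mul (Real.continuous_rpow_const (by positivity)))
      have h2 : ν A ≤ ENNReal.ofReal (C * Metric.diam A ^ (1 / s)) :=
        ge_of_tendsto ((hcont.tendsto (Metric.diam A)).mono_left nhdsWithin_le_nhds)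
          (Filter.eventually_of_mem (self_mem_nhdsWithin (s := Ioi (Metric.diam A))) h1)
      rwa [ENNReal.ofReal_mul hC.le, ← ENNReal.ofReal_rpow_of_nonneg Metric.diam_nonneg
        (by positivity), Metric.diam, ENNReal.ofReal_toReal hbd.ediam_ne_top] at h2
    have hle : (ENNReal.ofReal C)⁻¹ • ν ≤ Measure.hausdorffMeasure (1 / s) := by
      refine Measure.le_hausdorffMeasure _ _ 1 one_pos fun A _ => ?_
      rw [Measure.smul_apply, smul_eq_mul]
      refine (mul_le_mul_right (hdiam A) _).trans_eq ?_
      rw [← mul_assoc, ENNReal.inv_mul_cancel hC0 ENNReal.ofReal_ne_top, one_mul]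
    calc volume S ≤ ν (projLine s hs0 l '' S) := by
          refine le_trans ?_ (Measure.le_map_apply hmeas.aemeasurable _)
          rw [Measure.restrict_apply' measurableSet_Icc]
          exact measure_mono fun u hu => ⟨⟨u, hu, rfl⟩, hS hu⟩
      _ = ENNReal.ofReal C * ((ENNReal.ofReal C)⁻¹ • ν) (projLine s hs0 l '' S) := by
          rw [Measure.smul_apply, smul_eq_mul, ← mul_assoc,
            ENNReal.mul_inv_cancel hC0 ENNReal.ofReal_ne_top, one_mul]
      _ ≤ _ := mul_le_mul_right (hle _) _

end

/-- The biLipschitz pieces of the quotient of the unit interval can be taken to be cells. -/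
theorem exists_cell_pieces {s : ℝ} (hs0 : 0 < s) (hs1 : s < 1) {l : ℕ} (hl : 3 ≤ l)
    (hh : scale l ≤ 1 - s) :
    ∃ θ : ℝ, 0 < θ ∧ ∀ (x y : Set.Icc (0 : ℝ) 1) (r t : ℝ),
      IsRadius (Quot01 s hs0 l) r → IsRadius (Quot01 s hs0 l) t →
      ∃ (n : ℕ) (m : ℤ) (n' : ℕ) (m' : ℤ),
        NoShortcutAtEnds l n m ∧ NoShortcutAtEnds l n' m' ∧
        cell l n m ⊆ Set.Icc 0 1 ∧ cell l n' m' ⊆ Set.Icc 0 1 ∧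
        (∀ u ∈ cell l n m, dR s l x u < r) ∧
        (∀ u ∈ cell l n' m', dR s l y u < t) ∧
        IsClosed (proj s hs0 l '' {u | (u : ℝ) ∈ cell l n m}) ∧
        ENNReal.ofReal (θ * r ^ (1 / s)) ≤
          hausdorff (1 / s) (proj s hs0 l '' {u | (u : ℝ) ∈ cell l n m}) ∧
        ∀ u ∈ cell l n m, ∀ v ∈ cell l n m,
          (ratio s l * (r⁻¹ * dR s l u v) ≤
            t⁻¹ * dR s l (cellMap l n m n' m' u) (cellMap l n m n' m' v)) ∧
          (t⁻¹ * dR s l (cellMap l n m n' m' u) (cellMap l n m n' m' v) ≤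
            (ratio s l)⁻¹ * (r⁻¹ * dR s l u v)) := by
  obtain ⟨C, hC, -, hlow⟩ := exists_hausdorff_bounds hs0 hs1 hl hh
  have h0 := scale_pos l
  have hμ := ratio_pos s l
  -- A chosen cell has Lebesgue measure `h ^ n ≥ h ^ 2 * r ^ (1 / s)`, and passing to Hausdorff
  -- measure costs the factor `C`.
  refine ⟨scale l ^ 2 / C, by positivity, fun x y r t hr ht => ?_⟩
  have hr0 := hr.1
  have ht0 := ht.1
  obtain ⟨n, m, hnm, hsub, hball, hr1, hr2⟩ := exists_cell_in_ball hs0 hl x.2 hr0 hr.le_one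
  obtain ⟨n', m', hnm', hsub', hball', ht1, ht2⟩ := exists_cell_in_ball hs0 hl y.2 ht0 ht.le_one
  refine ⟨n, m, n', m', hnm, hnm', hsub, hsub', hball, hball', ?_, ?_, ?_⟩
  · rw [proj_image_eq hsub]
    exact (isCompact_Icc.image continuous_projLine).isClosed
  · rw [proj_image_eq hsub]
    have h1 := hlow _ hsub
    have h2 : volume (cell l n m) = ENNReal.ofReal (scale l ^ n) := by
      rw [cell, Real.volume_Icc]; congr 1; ring
    have h3 : scale l ^ 2 * r ^ (1 / s) ≤ scale l ^ n := by
      rw [← ratio_pow_rpow_inv hs0 l 2, ← ratio_pow_rpow_inv hs0 l n,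
        ← Real.mul_rpow (by positivity) hr0.le]
      exact Real.rpow_le_rpow (by positivity) hr1 (by positivity)
    rw [h2] at h1
    have h4 := (ENNReal.ofReal_le_ofReal h3).trans h1
    have hC0 : ENNReal.ofReal C ≠ 0 := by simpa using hC
    rw [div_mul_eq_mul_div, ENNReal.ofReal_div_of_pos hC]
    exact ENNReal.div_le_of_le_mul' h4
  · intro u hu v hv
    rw [hnm.dR_cellMap hs0 hs1 hl hh hnm' hu hv, zpow_sub₀ hμ.ne', zpow_natCast, zpow_natCast]
    have hd := dR_nonneg s l u v
    have hn : 0 < ratio s l ^ n := by positivity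
    -- Both `μ ^ n / r` and `μ ^ n' / t` lie in `[μ ^ 2, μ]`, so their quotient lies in `[μ, μ⁻¹]`.
    have key1 : ratio s l * r⁻¹ ≤ t⁻¹ * (ratio s l ^ n' / ratio s l ^ n) := by
      rw [← div_eq_mul_inv, ← div_eq_inv_mul, div_div, div_le_div_iff₀ hr0 (by positivity)]
      calc ratio s l * (ratio s l ^ n * t) ≤ ratio s l * (ratio s l * r * t) := by gcongr
        _ = ratio s l ^ 2 * t * r := by ring
        _ ≤ _ := by gcongr
    have key2 : t⁻¹ * (ratio s l ^ n' / ratio s l ^ n) ≤ (ratio s l)⁻¹ * r⁻¹ := by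
      rw [← mul_inv, ← div_eq_inv_mul, div_div, inv_eq_one_div,
        div_le_div_iff₀ (by positivity) (by positivity)]
      calc ratio s l ^ n' * (ratio s l * r) ≤ ratio s l * t * (ratio s l * r) := by gcongr
        _ = t * (ratio s l ^ 2 * r) := by ring
        _ ≤ t * ratio s l ^ n := by gcongr
        _ = _ := by ring
    rw [← mul_assoc, ← mul_assoc, ← mul_assoc]
    exact ⟨by gcongr, by gcongr⟩

theorem isBPI_quot01 {s : ℝ} (hs0 : 0 < s) (hs1 : s < 1) {l : ℕ} (hl : 3 ≤ l)
    (hh : scale l ≤ 1 - s) : IsBPI (Quot01 s hs0 l) (1 / s) := by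
  obtain ⟨C, hC, hup, -⟩ := exists_hausdorff_bounds hs0 hs1 hl hh
  obtain ⟨θ, hθ, H⟩ := exists_cell_pieces hs0 hs1 hl hh
  have hμ := ratio_pos s l
  refine ⟨⟨by positivity, inferInstance, C + θ⁻¹, by positivity, fun z r hr => ⟨?_, ?_⟩⟩,
    (ratio s l)⁻¹, θ, by positivity, hθ, fun z w r t hr ht => ?_⟩
  · obtain ⟨x, rfl⟩ := exists_proj_eq z
    have hr0 := hr.1
    -- The lower Ahlfors bound comes from the cell contained in the ball.
    obtain ⟨n, m, -, -, -, -, -, -, hball, -, -, hθr, -⟩ := H x x r r hr hr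
    refine (ENNReal.ofReal_le_ofReal ?_).trans (hθr.trans (hausdorff_mono ?_))
    · gcongr
      exact inv_le_of_inv_le₀ hθ (by linarith)
    · rintro _ ⟨u, hu, rfl⟩
      rw [Metric.mem_ball, dist_proj, dR_comm]
      exact hball u hu
  · have hr0 := hr.1
    refine (hup z r hr0).trans (ENNReal.ofReal_le_ofReal ?_)
    gcongr
    have : 0 < θ⁻¹ := by positivity
    linarith
  · obtain ⟨x, rfl⟩ := exists_proj_eq z
    obtain ⟨y, rfl⟩ := exists_proj_eq w
    obtain ⟨n, m, n', m', -, -, hsub, hsub', hball, hball', hcl, hθr, hf⟩ := H x y r t hr ht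
    have hex : ∀ a ∈ proj s hs0 l '' {u | (u : ℝ) ∈ cell l n m},
        ∃ u : ℝ, u ∈ cell l n m ∧ projLine s hs0 l u = a := by
      rintro _ ⟨u, hu, rfl⟩
      exact ⟨u, hu, projLine_of_mem u.2⟩
    -- Any choice of representatives in the cell works: the estimates involve only `dR`, which does
    -- not depend on the choice.
    choose! g hg hga using hex
    refine ⟨_, fun a => projLine s hs0 l (cellMap l n m n' m' (g a)), hcl, ?_, hθr, ?_, ?_⟩
    · rintro _ ⟨u, hu, rfl⟩
      rw [Metric.mem_ball, dist_proj, dR_comm]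
      exact hball u hu
    · intro a ha
      have hc := cellMap_mapsTo l n m n' m' (hg a ha)
      rw [Metric.mem_ball, ← projLine_of_mem y.2, dist_projLine (hsub' hc) y.2, dR_comm]
      exact hball' _ hc
    · intro a ha b hb
      have ha' := cellMap_mapsTo l n m n' m' (hg a ha)
      have hb' := cellMap_mapsTo l n m n' m' (hg b hb)
      have hdist : dist a b = dR s l (g a) (g b) := by
        rw [← dist_projLine (hs0 := hs0) (hsub (hg a ha)) (hsub (hg b hb)), hga a ha, hga b hb]
      rw [hdist, dist_projLine (hsub' ha') (hsub' hb'), inv_inv]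
      exact hf _ (hg a ha) _ (hg b hb)

/-- For `l ≤ 2` one has `h ≥ 1 / 4`, hence `μ ≥ (1 / 4) ^ s > 1 / 4` because `s < 1`. -/
theorem three_le_of_ratio_le {s : ℝ} (hs0 : 0 < s) (hs1 : s < 1) {l : ℕ}
    (h : ratio s l ≤ 1 / 4) : 3 ≤ l := by
  by_contra! hl
  have h1 : (1 / 4 : ℝ) ≤ scale l := by
    calc (1 / 4 : ℝ) = (1 / 2) ^ 2 := by norm_num
      _ ≤ (1 / 2) ^ l := pow_le_pow_of_le_one (by norm_num) (by norm_num) (by omega)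
  have h2 : (1 / 4 : ℝ) ^ s ≤ ratio s l := Real.rpow_le_rpow (by norm_num) h1 hs0.le
  have h3 : (1 / 4 : ℝ) ^ (1 : ℝ) < (1 / 4 : ℝ) ^ s :=
    Real.rpow_lt_rpow_of_exponent_gt (by norm_num) (by norm_num) hs1
  rw [Real.rpow_one] at h3
  linarith

theorem scale_le_of_ratio_le {s : ℝ} (hs0 : 0 < s) (hs1 : s < 1) {l : ℕ}
    (h : ratio s l ≤ (1 - s) ^ s) : scale l ≤ 1 - s :=
  (Real.rpow_le_rpow_iff (scale_pos l).le (by linarith) hs0).1 h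

end BPI

end

theorem mainTheorem6 (s : ℝ) (hs0 : 0 < s) (hs1 : s < 1) (l : ℕ) (hl1 : 1 ≤ l)
    (hl : BPI.ratio s l ≤
      min (1 / 4) (min ((1 - s) ^ s) (1 / 2 * ((2 : ℝ) ^ (l - 1) - 1) ^ (s / 2)))) :
    -- the identification by shortcuts is an equivalence relation on the line
    Equivalence (BPI.Rel l) ∧
    -- the quotient metric space is BPI of dimension `1 / s`
    BPI.IsBPI (BPI.Quot01 s hs0 l) (1 / s) ∧
    -- shortcuts inside `[0, 1]` suffice on `[0, 1]`
    (∀ x y : Set.Icc (0 : ℝ) 1,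
      BPI.dR s l x y = BPI.dRestrict s l (Set.Icc 0 1) x y) ∧
    -- shortcuts inside an interval without shortcut at the ends suffice on that interval
    (∀ (n : ℕ) (m : ℤ), BPI.NoShortcutAtEnds l n m → ∀ x y : BPI.cell l n m,
      BPI.dR s l x y = BPI.dRestrict s l (BPI.cell l n m) x y) ∧
    -- the affine bijection between two such intervals is a similitude
    (∀ (n : ℕ) (m : ℤ) (n' : ℕ) (m' : ℤ),
      BPI.NoShortcutAtEnds l n m → BPI.NoShortcutAtEnds l n' m' →
      Set.BijOn (BPI.cellMap l n m n' m') (BPI.cell l n m) (BPI.cell l n' m') ∧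
      ∀ x ∈ BPI.cell l n m, ∀ y ∈ BPI.cell l n m,
        BPI.dR s l (BPI.cellMap l n m n' m' x) (BPI.cellMap l n m n' m' y) =
          BPI.ratio s l ^ ((n' : ℤ) - (n : ℤ)) * BPI.dR s l x y) ∧
    -- big pieces of any two balls can be chosen to be such intervals, with biLipschitz
    -- constant `μ⁻¹` for the rescaled distances
    (∃ θ : ℝ, 0 < θ ∧ ∀ (x y : Set.Icc (0 : ℝ) 1) (r t : ℝ),
      BPI.IsRadius (BPI.Quot01 s hs0 l) r → BPI.IsRadius (BPI.Quot01 s hs0 l) t →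
      ∃ (n : ℕ) (m : ℤ) (n' : ℕ) (m' : ℤ),
        BPI.NoShortcutAtEnds l n m ∧ BPI.NoShortcutAtEnds l n' m' ∧
        BPI.cell l n m ⊆ Set.Icc 0 1 ∧ BPI.cell l n' m' ⊆ Set.Icc 0 1 ∧
        (∀ u ∈ BPI.cell l n m, BPI.dR s l x u < r) ∧
        (∀ u ∈ BPI.cell l n' m', BPI.dR s l y u < t) ∧
        IsClosed (BPI.proj s hs0 l '' {u | (u : ℝ) ∈ BPI.cell l n m}) ∧
        ENNReal.ofReal (θ * r ^ (1 / s)) ≤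
          BPI.hausdorff (1 / s) (BPI.proj s hs0 l '' {u | (u : ℝ) ∈ BPI.cell l n m}) ∧
        ∀ u ∈ BPI.cell l n m, ∀ v ∈ BPI.cell l n m,
          (BPI.ratio s l * (r⁻¹ * BPI.dR s l u v) ≤
            t⁻¹ * BPI.dR s l (BPI.cellMap l n m n' m' u) (BPI.cellMap l n m n' m' v)) ∧
          (t⁻¹ * BPI.dR s l (BPI.cellMap l n m n' m' u) (BPI.cellMap l n m n' m' v) ≤
            (BPI.ratio s l)⁻¹ * (r⁻¹ * BPI.dR s l u v))) := by
  have hl3 := BPI.three_le_of_ratio_le hs0 hs1 (hl.trans (min_le_left _ _))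
  have hh := BPI.scale_le_of_ratio_le hs0 hs1
    (hl.trans ((min_le_right _ _).trans (min_le_left _ _)))
  refine ⟨BPI.rel_equivalence hl3, BPI.isBPI_quot01 hs0 hs1 hl3 hh, ?_,
    fun n m h x y => h.dR_eq_dRestrict hs0 hs1 hl3 hh x y,
    fun n m n' m' h h' => ⟨BPI.cellMap_bijOn l n m n' m', fun x hx y hy =>
      h.dR_cellMap hs0 hs1 hl3 hh h' hx hy⟩, BPI.exists_cell_pieces hs0 hs1 hl3 hh⟩
  -- The unit interval is a cell of level `0`, and integers are never ends of shortcuts.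
  rw [← BPI.cell_zero l]
  exact fun x y => (BPI.noShortcutAtEnds_zero hl3 0).dR_eq_dRestrict hs0 hs1 hl3 hh x y
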